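/- Let $\Sigma$ be a finite or countably infinite alphabet known to both parties. Alice holds a string $A\in\Sigma^*$ and Bob holds a string $B\in\Sigma^*$, of arbitrary finite lengths that are not known to the other party. Let $\ell$ be the length of the longest common prefix $L$ of $A$ and $B$, and let $z$ be the number of phrases in the LZ77 parse without self-references of $L$. This parse divides $L$ greedily from left to right into phrases. The phrase starting at position $u$ consists of the longest string starting at $u$ that also occurs in $L$ at an earlier position, entirely to the left of $u$, and is followed in $L$ by a further symbol, together with that following symbol. In a public-coin protocol the parties share an infinite sequence of independent unbiased coin tosses. They exchange bits; the coins and the bits exchanged so far determine who sends the next bit, or that the protocol stops and with which output, and each bit sent depends only on these and on the input of its sender. The number of rounds is the number of maximal blocks of consecutive bits sent by the same party. Then for every $\varepsilon$ with $0<\varepsilon<1/2$ there is a constant $C$, depending only on $\varepsilon$, such that for every such $\Sigma$ there is a single public-coin protocol with the following properties for all $A,B\in\Sigma^*$. The protocol stops for every outcome of the coin tosses; and with probability at least $1-\varepsilon$ it outputs $\ell$ after at most $C\lg(z+2)$ rounds, that is $O(1+\lg z)$ when $z\ge 1$ and $O(1)$ when $z=0$, and at most $C\lg(\ell+2)$ bits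 of communication in total. -/

import Mathlib

/-! ### Two-party communication protocols -/

/-- The two players. Alice holds an input from `X`, Bob an input from `Y`. -/
inductive Party where
  | alice
  | bob
  deriving DecidableEq

instance : Fintype Party := ⟨{.alice, .bob}, by rintro (_ | _) <;> simp⟩

/-- What happens at a node of a protocol tree: one of the players sends the next bit, or the
protocol stops with an output. -/
inductive ProtocolAction (O : Type*) where
  | speak (p : Party)
  | halt (o : O)

/-- The communication so far, oldest bit first; every bit is recorded with its sender. -/
abbrev Transcript := List (Party × Bool)

/-- A deterministic two-party protocol tree. The transcript alone decides who sends the next bit,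
whether the protocol stops, and with which output (so that both players learn the output). The bit
that a player sends depends only on the player's own input and on the transcript. -/
structure Protocol (X Y O : Type*) where
  action : Transcript → ProtocolAction O
  aliceBit : X → Transcript → Bool
  bobBit : Y → Transcript → Bool

namespace Protocol

variable {X Y O : Type*}

/-- The transcript after one more bit (unchanged if the protocol has stopped). -/
def step (P : Protocol X Y O) (x : X) (y : Y) (t : Transcript) : Transcript :=
  match P.action t with
  | .speak .alice => t ++ [(.alice, P.aliceBit x t)]
  | .speak .bob => t ++ [(.bob, P.bobBit y t)]
  | .halt _ => t

/-- The transcript after `k` steps on the input pair `(x, y)`. -/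
def run (P : Protocol X Y O) (x : X) (y : Y) : ℕ → Transcript
  | 0 => []
  | k + 1 => P.step x y (P.run x y k)

/-- On the input pair `(x, y)` the protocol stops, with complete transcript `t` and output `o`. -/
def HaltsWith (P : Protocol X Y O) (x : X) (y : Y) (t : Transcript) (o : O) : Prop :=
  (∃ k, P.run x y k = t) ∧ P.action t = .halt o

end Protocol

/-- The number of bits communicated in a transcript. -/
def Transcript.bits (t : Transcript) : ℕ := t.length

/-- The number of rounds of a transcript: the number of maximal blocks of consecutive bits sent by
the same player. -/
def Transcript.rounds (t : Transcript) : ℕ := ((t.map Prod.fst).destutter (· ≠ ·)).length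

/-- The shared random string: an infinite sequence of bits. -/
abbrev Coins := ℕ → Bool

/-- The law of the shared random string: independent unbiased coin tosses. -/
noncomputable def coinLaw : MeasureTheory.Measure Coins :=
  MeasureTheory.Measure.infinitePi fun _ : ℕ => (PMF.uniformOfFintype Bool).toMeasure

/-- A randomized public-coin protocol: a deterministic protocol for every value of the shared random
string, chosen measurably. -/
structure PublicCoinProtocol (X Y O : Type*) where
  det : Coins → Protocol X Y O
  measurableSet_action : ∀ (t : Transcript) (S : Set (ProtocolAction O)),
    MeasurableSet {r | (det r).action t ∈ S}
  measurable_aliceBit : ∀ (x : X) (t : Transcript), Measurable fun r => (det r).aliceBit x t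
  measurable_bobBit : ∀ (y : Y) (t : Transcript), Measurable fun r => (det r).bobBit y t

/-! ### Strings -/

open Classical in
/-- The longest common prefix of two strings. -/
noncomputable def lcp {α : Type*} : List α → List α → List α
  | a :: A, b :: B => if a = b then a :: lcp A B else []
  | _, _ => []

open Classical in
/-- The length of the copied part of the next phrase, where `past` has been parsed already and
`rest` is still to be parsed: the largest `l` such that the first `l` symbols of `rest` occur as a
substring of `past` (no self-reference) and are followed in `rest` by a further symbol. -/
noncomputable def copyLength {α : Type*} (past rest : List α) : ℕ :=
  Nat.findGreatest (fun l => l < rest.length ∧ rest.take l <:+: past) rest.length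

/-- The greedy left-to-right parse of `rest` into phrases, where `past` has been parsed already:
every phrase is a copied part together with the symbol following it. -/
noncomputable def lz77From {α : Type*} (past rest : List α) : List (List α) :=
  if h : rest = [] then []
  else
    have : 0 < rest.length := List.length_pos_iff.mpr h
    rest.take (copyLength past rest + 1) ::
      lz77From (past ++ rest.take (copyLength past rest + 1))
        (rest.drop (copyLength past rest + 1))
termination_by rest.length
decreasing_by simp only [List.length_drop]; omega

/-- The phrases of the LZ77 parse, without self-references, of a string. -/
noncomputable def lz77 {α : Type*} (S : List α) : List (List α) := lz77From [] S

/-! ### Counting rounds -/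

/-! Append different end markers to the two inputs, so that neither marked string `S`, `T` is a
prefix of the other and their longest common prefix is still `L`. Each party parses its own marked
string. Cutting a string to a prefix only truncates its parse (`phraseEnd_of_prefix`), so agreement
of the first `k` phrases is antitone in `k` and fails at `k = z + 1` (`phrasePrefix_succ_ne`). The
last `k` with agreement is therefore at most `z`, and it can be found by comparing hashes of phrase
prefixes.

Doubling locates the first power `2 ^ j` at which agreement fails, with `j` at most about `lg z +
1`. Binary search on `[0, 2 ^ j]` then uses hashes of a constant number `b` of bits. Equal strings
always pass a test and different ones pass with probability `2⁻ᵇ`, so errors are one-sided. The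
search rechecks its lower end and backtracks when that fails. A potential argument shows that `3 *
j` steps tolerate fewer than `j` errors (`searchRun_correct`), and Markov's inequality bounds the
probability of more (`coinLaw_searchErrors_le`). Constant-size hashes keep this stage at `O(lg z)`
bits.

Once `k` is known, `L` ends at the latest with the copied part of Alice's next phrase
(`lcp_eq_of_phrasePrefix_succ_ne`). That part is a substring of the common phrase prefix, so a
position and a length let Bob rebuild it, compute `ℓ` and send it. Both numbers are at most the end
`u ≤ ℓ` of the common phrases. Their bit length is announced by testing `u < 2 ^ 2 ^ e` for
increasing `e`, which costs a factor of at most two in bits beyond an additive constant; since `u <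
2 ^ k`, it takes only `O(j)` rounds. -/

theorem destutter'_replicate {α : Type*} [DecidableEq α] (a : α) (n : ℕ) :
    ((List.replicate n a).destutter' (· ≠ ·) a) = [a] := by
  induction n with
  | zero => simp
  | succ n ih => simp [List.replicate_succ, ih]

theorem length_destutter'_append_replicate_le {α : Type*} [DecidableEq α] (l : List α) (a p : α)
    (n : ℕ) : ((l ++ List.replicate n p).destutter' (· ≠ ·) a).length ≤
      (l.destutter' (· ≠ ·) a).length + 1 := by
  induction l generalizing a with
  | nil =>
    cases n with
    | zero => simp
    | succ n =>
      by_cases h : a = p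
      · subst h
        simp [List.replicate_succ, List.destutter', destutter'_replicate]
      · simp [List.replicate_succ, List.destutter', h, destutter'_replicate]
  | cons b l ih =>
    by_cases h : a = b
    · subst h
      simpa [List.destutter'] using ih a
    · simpa [List.destutter', h] using ih b

theorem length_destutter_append_replicate_le {α : Type*} [DecidableEq α] (l : List α) (p : α)
    (n : ℕ) : ((l ++ List.replicate n p).destutter (· ≠ ·)).length ≤
      (l.destutter (· ≠ ·)).length + 1 := by
  cases l with
  | nil =>
    cases n with
    | zero => simp
    | succ n => simp [List.replicate_succ, List.destutter, destutter'_replicate]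
  | cons b l => simpa [List.destutter] using length_destutter'_append_replicate_le l b p n

theorem Transcript.rounds_append_le (t u : Transcript) (p : Party) (h : ∀ e ∈ u, e.1 = p) :
    Transcript.rounds (t ++ u) ≤ Transcript.rounds t + 1 := by
  have : u.map Prod.fst = List.replicate u.length p := by
    rw [List.eq_replicate_iff]
    refine ⟨by simp, fun b hb => ?_⟩
    obtain ⟨e, he, rfl⟩ := List.mem_map.mp hb
    exact h e he
  unfold Transcript.rounds
  rw [List.map_append, this]
  exact length_destutter_append_replicate_le _ _ _

/-! ### Protocols in which the parties alternately send blocks of bits -/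

/-- The bits of a finite list, extended by `false`. -/
def bitsOf (l : List Bool) (i : ℕ) : Bool := l.getD i false

/-- The first `w` bits of a sequence, extended by `false`. -/
def maskBits (w : ℕ) (f : ℕ → Bool) (i : ℕ) : Bool := if i < w then f i else false

theorem bitsOf_map_range (w : ℕ) (f : ℕ → Bool) :
    bitsOf ((List.range w).map f) = maskBits w f := by
  funext i
  by_cases h : i < w <;> simp [bitsOf, maskBits, h]

/-- A public-coin protocol given by a state machine: in each step, first Alice and then Bob send a
block of bits, whose length is determined by the state. -/
structure BlockProtocol (X Y O : Type*) where
  State : Type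
  start : State
  output : State → Option O
  width : State → ℕ
  width_pos : ∀ s, 0 < width s
  next : State → (ℕ → Bool) → (ℕ → Bool) → State
  aliceMsg : Coins → X → State → ℕ → Bool
  bobMsg : Coins → Y → State → ℕ → Bool
  measurable_aliceMsg : ∀ x s i, Measurable fun r => aliceMsg r x s i
  measurable_bobMsg : ∀ y s i, Measurable fun r => bobMsg r y s i

namespace BlockProtocol

variable {X Y O : Type*} (M : BlockProtocol X Y O)

/-- Read one bit: the current state together with the bits read since it was entered. -/
def feed (q : M.State × List Bool) (e : Party × Bool) : M.State × List Bool :=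
  if q.2.length + 1 < M.width q.1 + M.width q.1 then (q.1, q.2 ++ [e.2])
  else (M.next q.1 (bitsOf ((q.2 ++ [e.2]).take (M.width q.1)))
    (bitsOf ((q.2 ++ [e.2]).drop (M.width q.1))), [])

/-- The state reached after a transcript, and the bits of the current step. -/
def parse (t : Transcript) : M.State × List Bool := t.foldl M.feed (M.start, [])

/-- The deterministic protocol for a given outcome of the coins. -/
def toProtocol (r : Coins) : Protocol X Y O where
  action t :=
    match M.output (M.parse t).1 with
    | some o => .halt o
    | none => if (M.parse t).2.length < M.width (M.parse t).1 then .speak .alice else .speak .bob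
  aliceBit x t := M.aliceMsg r x (M.parse t).1 (M.parse t).2.length
  bobBit y t := M.bobMsg r y (M.parse t).1 ((M.parse t).2.length - M.width (M.parse t).1)

/-- The public-coin protocol described by the state machine. -/
def toPublicCoin : PublicCoinProtocol X Y O where
  det := M.toProtocol
  -- The coins enter only through the messages; the action at a transcript is the same for all of
  -- them.
  measurableSet_action t S := MeasurableSet.const
    ((M.toProtocol fun _ => false).action t ∈ S)
  measurable_aliceBit x _ := M.measurable_aliceMsg x _ _
  measurable_bobBit y _ := M.measurable_bobMsg y _ _

variable (r : Coins) (x : X) (y : Y)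

/-- The state after one step from the state `s`. -/
def advance (s : M.State) : M.State :=
  M.next s (maskBits (M.width s) (M.aliceMsg r x s)) (maskBits (M.width s) (M.bobMsg r y s))

/-- The `i`-th bit sent in the step from the state `s`, with its sender. -/
def entry (s : M.State) (i : ℕ) : Party × Bool :=
  if i < M.width s then (.alice, M.aliceMsg r x s i) else (.bob, M.bobMsg r y s (i - M.width s))

/-- Started in state `s`, the protocol stops after `n` steps, in which `c` bits are sent, with
output `o`. -/
inductive Finishes : M.State → ℕ → ℕ → O → Prop
  | halt {s : M.State} {o : O} : M.output s = some o → Finishes s 0 0 o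
  | step {s : M.State} {n c : ℕ} {o : O} : M.output s = none →
      Finishes (M.advance r x y s) n c o → Finishes s (n + 1) (c + 2 * M.width s) o

theorem foldl_feed_of_lt (s : M.State) (e : ℕ → Party × Bool) (n : ℕ)
    (h : n < M.width s + M.width s) :
    ((List.range n).map e).foldl M.feed (s, []) = (s, (List.range n).map fun i => (e i).2) := by
  induction n with
  | zero => simp
  | succ n ih =>
    rw [List.range_succ, List.map_append, List.foldl_append, ih (by omega)]
    simp [feed, h]

theorem foldl_feed_block (s : M.State) :
    ((List.range (M.width s + M.width s)).map (M.entry r x y s)).foldl M.feed (s, []) =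
      (M.advance r x y s, []) := by
  -- The last bit of the step triggers the transition, so it is split off from those that are merely
  -- buffered.
  obtain ⟨n, hn⟩ : ∃ n, M.width s + M.width s = n + 1 :=
    ⟨M.width s + M.width s - 1, by have := M.width_pos s; omega⟩
  have key : (List.range (M.width s + M.width s)).map (fun i => (M.entry r x y s i).2) =
      (List.range (M.width s)).map (M.aliceMsg r x s) ++
        (List.range (M.width s)).map (M.bobMsg r y s) := by
    rw [List.range_add, List.map_append, List.map_map]
    congr 1
    · refine List.map_congr_left fun i hi => ?_
      simp [entry, List.mem_range.mp hi]
    · refine List.map_congr_left fun i hi => ?_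
      simp [entry]
  have key' : (List.range n).map (fun i => (M.entry r x y s i).2) ++ [(M.entry r x y s n).2] =
      (List.range (M.width s)).map (M.aliceMsg r x s) ++
        (List.range (M.width s)).map (M.bobMsg r y s) := by
    rw [← key, hn, List.range_succ, List.map_append]; rfl
  rw [hn, List.range_succ, List.map_append, List.foldl_append,
    foldl_feed_of_lt M s _ n (by omega)]
  simp only [List.map_cons, List.map_nil, List.foldl_cons, List.foldl_nil, feed]
  rw [if_neg (by simp; omega), key']
  simp [advance, bitsOf_map_range]

theorem step_toProtocol (t : Transcript) (s : M.State) (buf : List Bool)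
    (ht : M.parse t = (s, buf)) (hs : M.output s = none) :
    (M.toProtocol r).step x y t = t ++ [M.entry r x y s buf.length] := by
  unfold Protocol.step
  by_cases h : buf.length < M.width s
  · have : (M.toProtocol r).action t = .speak .alice := by simp [toProtocol, ht, hs, h]
    rw [this]
    simp [toProtocol, ht, entry, h]
  · have : (M.toProtocol r).action t = .speak .bob := by simp [toProtocol, ht, hs, h]
    rw [this]
    simp [toProtocol, ht, entry, h]

theorem action_toProtocol (t : Transcript) {q : M.State × List Bool} (ht : M.parse t = q) {o : O}
    (ho : M.output q.1 = some o) : (M.toProtocol r).action t = .halt o := by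
  simp [toProtocol, ht, ho]

theorem run_add_of_parse (k : ℕ) (s : M.State) (n : ℕ)
    (ht : M.parse ((M.toProtocol r).run x y k) = (s, [])) (hs : M.output s = none)
    (hn : n ≤ M.width s + M.width s) :
    (M.toProtocol r).run x y (k + n) =
      (M.toProtocol r).run x y k ++ (List.range n).map (M.entry r x y s) := by
  induction n with
  | zero => simp
  | succ n ih =>
    have hp : M.parse ((M.toProtocol r).run x y k ++ (List.range n).map (M.entry r x y s)) =
        (s, (List.range n).map fun i => (M.entry r x y s i).2) := by
      unfold parse at ht ⊢
      rw [List.foldl_append, ht, foldl_feed_of_lt M s _ n (by omega)]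
    rw [← Nat.add_assoc, Protocol.run, ih (by omega), step_toProtocol M r x y _ s _ hp hs,
      List.range_succ, List.map_append, List.append_assoc]
    simp

theorem rounds_append_block_le (t : Transcript) (s : M.State) :
    Transcript.rounds (t ++ (List.range (M.width s + M.width s)).map (M.entry r x y s)) ≤
      Transcript.rounds t + 2 := by
  rw [List.range_add, List.map_append, ← List.append_assoc]
  refine (Transcript.rounds_append_le _ _ .bob ?_).trans
    (Nat.add_le_add_right (Transcript.rounds_append_le _ _ .alice ?_) 1)
  · simp only [List.mem_map, List.mem_range]
    rintro e ⟨i, ⟨j, -, rfl⟩, rfl⟩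
    simp [entry]
  · simp only [List.mem_map, List.mem_range]
    rintro e ⟨i, hi, rfl⟩
    simp [entry, hi]

/-- Every step appends one block of Alice's bits and one of Bob's, hence at most two rounds. The
time `k` is general because the induction restarts in the middle of a run. -/
theorem Finishes.haltsWith {s : M.State} {n c : ℕ} {o : O} (h : M.Finishes r x y s n c o) (k : ℕ)
    (ht : M.parse ((M.toProtocol r).run x y k) = (s, [])) :
    ∃ t, (M.toProtocol r).HaltsWith x y t o ∧
      Transcript.rounds t ≤ Transcript.rounds ((M.toProtocol r).run x y k) + 2 * n ∧
      Transcript.bits t = Transcript.bits ((M.toProtocol r).run x y k) + c := by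
  induction h generalizing k with
  | halt ho => exact ⟨_, ⟨⟨k, rfl⟩, action_toProtocol M r _ ht ho⟩, le_rfl, rfl⟩
  | @step s n c o hs _ ih =>
    have hrun := run_add_of_parse M r x y k s _ ht hs le_rfl
    obtain ⟨t, h1, h2, h3⟩ := ih (k + (M.width s + M.width s)) (by
      rw [hrun]
      unfold parse at ht ⊢
      rw [List.foldl_append, ht, foldl_feed_block])
    refine ⟨t, h1, h2.trans ?_, h3.trans ?_⟩
    · rw [hrun]
      have := M.rounds_append_block_le r x y ((M.toProtocol r).run x y k) s
      omega
    · rw [hrun]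
      simp [Transcript.bits]
      omega

variable {M r x y} in
theorem Finishes.exists_transcript {n c : ℕ} {o : O} (h : M.Finishes r x y M.start n c o) :
    ∃ t, (M.toPublicCoin.det r).HaltsWith x y t o ∧
      Transcript.rounds t ≤ 2 * n ∧ Transcript.bits t = c := by
  obtain ⟨t, h1, h2, h3⟩ := Finishes.haltsWith M r x y h 0 rfl
  refine ⟨t, h1, h2.trans ?_, h3.trans ?_⟩ <;>
    simp [Protocol.run, Transcript.rounds, Transcript.bits]

end BlockProtocol

/-! ### Longest common prefixes -/

section lcp

variable {α β : Type*}

theorem lcp_prefix_left (A B : List α) : lcp A B <+: A := by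
  induction A generalizing B with
  | nil => simp [lcp]
  | cons a A ih =>
    cases B with
    | nil => simp [lcp]
    | cons b B =>
      by_cases h : a = b
      · simpa [lcp, h] using ih B
      · simp [lcp, h]

theorem lcp_prefix_right (A B : List α) : lcp A B <+: B := by
  induction A generalizing B with
  | nil => simp [lcp]
  | cons a A ih =>
    cases B with
    | nil => simp [lcp]
    | cons b B =>
      by_cases h : a = b
      · simpa [lcp, h] using ih B
      · simp [lcp, h]

theorem prefix_lcp {P A B : List α} (hA : P <+: A) (hB : P <+: B) : P <+: lcp A B := by
  induction P generalizing A B with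
  | nil => simp
  | cons p P ih =>
    obtain ⟨A', rfl⟩ := hA
    obtain ⟨B', rfl⟩ := hB
    simpa [lcp] using ih (List.prefix_append P A') (List.prefix_append P B')

theorem lcp_eq_lcp_take {S T : List α} {n : ℕ} (h : ¬ S.take (n + 1) <+: T) :
    lcp S T = lcp (S.take n) T := by
  have hn : (lcp S T).length ≤ n := by
    by_contra hlt
    apply h
    have h1 : S.take (n + 1) <+: lcp S T := by
      refine List.prefix_of_prefix_length_le (List.take_prefix _ _) (lcp_prefix_left S T) ?_
      rw [List.length_take]; omega
    exact h1.trans (lcp_prefix_right S T)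
  have h1 : lcp S T <+: lcp (S.take n) T := by
    refine prefix_lcp ?_ (lcp_prefix_right S T)
    rw [List.prefix_take_iff]
    exact ⟨lcp_prefix_left S T, hn⟩
  have h2 : lcp (S.take n) T <+: lcp S T :=
    prefix_lcp ((lcp_prefix_left _ _).trans (List.take_prefix _ _)) (lcp_prefix_right _ _)
  exact h1.eq_of_length_le h2.length_le

theorem lcp_map_append_singleton {f : α → β} (hf : Function.Injective f) {x y : β}
    (hx : ∀ a, f a ≠ x) (hy : ∀ a, f a ≠ y) (hxy : x ≠ y) (A B : List α) :
    lcp (A.map f ++ [x]) (B.map f ++ [y]) = (lcp A B).map f := by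
  induction A generalizing B with
  | nil =>
    cases B with
    | nil => simp [lcp, hxy]
    | cons b B => simp [lcp, (hx b).symm]
  | cons a A ih =>
    cases B with
    | nil => simp [lcp, hy a]
    | cons b B =>
      by_cases h : a = b
      · subst h
        simpa [lcp] using ih B
      · simp [lcp, h, hf.ne h]

end lcp

/-! ### The ends of the phrases of the LZ77 parse -/

section phraseEnd

variable {α β : Type*}

theorem copyLength_lt {past rest : List α} (h : rest ≠ []) :
    copyLength past rest < rest.length ∧ rest.take (copyLength past rest) <:+: past := by
  classical
  have h0 : 0 < rest.length := List.length_pos_iff.mpr h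
  unfold copyLength
  exact Nat.findGreatest_spec (P := fun l => l < rest.length ∧ rest.take l <:+: past)
    (Nat.zero_le _) ⟨h0, by simp⟩

theorem le_copyLength {past rest : List α} {l : ℕ} (hl : l < rest.length)
    (h : rest.take l <:+: past) : l ≤ copyLength past rest := by
  classical
  exact Nat.le_findGreatest hl.le ⟨hl, h⟩

theorem copyLength_map {f : α → β} (hf : Function.Injective f) (past rest : List α) :
    copyLength (past.map f) (rest.map f) = copyLength past rest := by
  have key (l : ℕ) : (rest.take l).map f <:+: past.map f ↔ rest.take l <:+: past := by
    rw [List.infix_map_iff]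
    refine ⟨?_, fun h => ⟨_, h, rfl⟩⟩
    rintro ⟨l', h', h⟩
    rwa [List.map_injective_iff.mpr hf h]
  unfold copyLength
  rw [List.length_map]
  congr! 3 with l
  rw [← List.map_take, key]

/-- The position at which the `k`-th phrase of the LZ77 parse of `S` ends. -/
noncomputable def phraseEnd (S : List α) : ℕ → ℕ
  | 0 => 0
  | k + 1 =>
    if phraseEnd S k < S.length then
      phraseEnd S k + copyLength (S.take (phraseEnd S k)) (S.drop (phraseEnd S k)) + 1
    else phraseEnd S k

theorem drop_ne_nil_of_lt {S : List α} {u : ℕ} (h : u < S.length) : S.drop u ≠ [] := by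
  simpa using h

theorem phraseEnd_le_length (S : List α) (k : ℕ) : phraseEnd S k ≤ S.length := by
  induction k with
  | zero => simp [phraseEnd]
  | succ k ih =>
    rw [phraseEnd]
    split_ifs with h
    · have := (copyLength_lt (past := S.take (phraseEnd S k)) (drop_ne_nil_of_lt h)).1
      rw [List.length_drop] at this
      omega
    · exact ih

theorem phraseEnd_lt_succ {S : List α} {k : ℕ} (h : phraseEnd S k < S.length) :
    phraseEnd S k < phraseEnd S (k + 1) := by
  rw [phraseEnd, if_pos h]; omega

theorem phraseEnd_le_succ (S : List α) (k : ℕ) : phraseEnd S k ≤ phraseEnd S (k + 1) := by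
  rw [phraseEnd]; split_ifs <;> omega

theorem phraseEnd_mono (S : List α) : Monotone (phraseEnd S) :=
  monotone_nat_of_le_succ (phraseEnd_le_succ S)

/-- Without self-reference a copied part is no longer than the text before it, so a phrase takes `u`
to at most `2 * u + 1`. -/
theorem phraseEnd_lt_two_pow (S : List α) (k : ℕ) : phraseEnd S k < 2 ^ k := by
  induction k with
  | zero => simp [phraseEnd]
  | succ k ih =>
    rw [phraseEnd, pow_succ]
    split_ifs with h
    · have h1 := copyLength_lt (past := S.take (phraseEnd S k)) (drop_ne_nil_of_lt h)
      have h2 := h1.2.length_le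
      have h3 := h1.1
      rw [List.length_take, List.length_take, List.length_drop] at h2
      rw [List.length_drop] at h3
      omega
    · omega

theorem min_le_phraseEnd (S : List α) (k : ℕ) : min k S.length ≤ phraseEnd S k := by
  induction k with
  | zero => simp
  | succ k ih =>
    have := phraseEnd_le_length S k
    rw [phraseEnd]; split_ifs <;> omega

theorem phraseEnd_map {f : α → β} (hf : Function.Injective f) (S : List α) (k : ℕ) :
    phraseEnd (S.map f) k = phraseEnd S k := by
  induction k with
  | zero => rfl
  | succ k ih =>
    rw [phraseEnd, phraseEnd, ih, ← List.map_take, ← List.map_drop, copyLength_map hf,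
      List.length_map]

/-- The greedy choice looks only at earlier text, so the parses coincide until a phrase of `S`
reaches the end of `L`. There a shorter initial piece of the copied part still occurs earlier, and
the phrase of `L` ends exactly at its last symbol. -/
theorem phraseEnd_of_prefix {L S : List α} (h : L <+: S) (k : ℕ) :
    phraseEnd L k = min (phraseEnd S k) L.length := by
  obtain ⟨R, rfl⟩ := h
  induction k with
  | zero => simp [phraseEnd]
  | succ k ih =>
    have hle := phraseEnd_le_succ (L ++ R) k
    by_cases hL : phraseEnd (L ++ R) k < L.length
    · set u := phraseEnd (L ++ R) k with hu
      have hu' : phraseEnd L k = u := by omega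
      have hS : u < (L ++ R).length := by rw [List.length_append]; omega
      rw [phraseEnd, phraseEnd, hu', ← hu, if_pos hL, if_pos hS,
        List.take_append_of_le_length hL.le, List.drop_append_of_le_length hL.le]
      set c := copyLength (L.take u) (L.drop u ++ R) with hc
      obtain ⟨c1, c2⟩ := copyLength_lt (past := L.take u) (rest := L.drop u ++ R)
        (by simpa using fun h => absurd h (by omega))
      obtain ⟨d1, d2⟩ := copyLength_lt (past := L.take u) (drop_ne_nil_of_lt hL)
      rw [← hc] at c1 c2
      set d := copyLength (L.take u) (L.drop u) with hd
      rw [List.length_append, List.length_drop] at c1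
      have h1 : d ≤ c := by
        refine le_copyLength (by rw [List.length_append]; omega) ?_
        rwa [List.take_append_of_le_length d1.le]
      rw [List.length_drop] at d1
      by_cases hcL : c < L.length - u
      · have h2 : c ≤ d := by
          refine le_copyLength (by rw [List.length_drop]; omega) ?_
          rwa [List.take_append_of_le_length (by rw [List.length_drop]; omega)] at c2
        omega
      · have h2 : L.length - u - 1 ≤ d := by
          refine le_copyLength (by rw [List.length_drop]; omega) ?_
          refine List.IsInfix.trans ?_ c2
          rw [← List.take_append_of_le_length (l₂ := R) (by rw [List.length_drop]; omega)]
          exact (List.take_prefix_take_left (by omega)).isInfix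
        omega
    · have : phraseEnd L (k + 1) = phraseEnd L k := by
        rw [phraseEnd, if_neg (by omega)]
      omega

theorem phraseEnd_add_length_lz77From (S : List α) (n k : ℕ) (hn : S.length - phraseEnd S k = n) :
    phraseEnd S (k + (lz77From (S.take (phraseEnd S k)) (S.drop (phraseEnd S k))).length) =
      S.length := by
  induction n using Nat.strong_induction_on generalizing k with
  | _ n ih =>
    have hle := phraseEnd_le_length S k
    rw [lz77From]
    by_cases h : S.drop (phraseEnd S k) = []
    · rw [dif_pos h]
      rw [List.drop_eq_nil_iff] at h
      simpa using le_antisymm hle h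
    · rw [dif_neg h]
      have hlt : phraseEnd S k < S.length := by simpa using h
      have hsucc := phraseEnd_lt_succ hlt
      have h1 := ih _ (by omega) (k + 1) rfl
      rw [List.length_cons, Nat.add_comm _ 1, ← Nat.add_assoc]
      have h2 : phraseEnd S (k + 1) = phraseEnd S k +
          (copyLength (S.take (phraseEnd S k)) (S.drop (phraseEnd S k)) + 1) := by
        rw [phraseEnd, if_pos hlt, Nat.add_assoc]
      rw [h2, ← List.drop_drop, List.take_add] at h1
      exact h1

theorem phraseEnd_length_lz77 (S : List α) : phraseEnd S (lz77 S).length = S.length := by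
  simpa [phraseEnd, lz77] using phraseEnd_add_length_lz77From S _ 0 rfl

theorem length_lz77From_le (past rest : List α) :
    (lz77From past rest).length ≤ rest.length := by
  induction hn : rest.length using Nat.strong_induction_on generalizing past rest with
  | _ n ih =>
    rw [lz77From]
    split_ifs with h
    · simp
    · have h0 : 0 < rest.length := List.length_pos_iff.mpr h
      rw [List.length_cons]
      have := ih _ (by rw [List.length_drop, ← hn]; omega)
        (past ++ rest.take (copyLength past rest + 1)) (rest.drop (copyLength past rest + 1)) rfl
      rw [List.length_drop] at this
      omega

theorem length_lz77_le (S : List α) : (lz77 S).length ≤ S.length := length_lz77From_le _ _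

/-- The first `k` phrases of the LZ77 parse of `S`, concatenated. -/
noncomputable def phrasePrefix (S : List α) (k : ℕ) : List α := S.take (phraseEnd S k)

theorem phrasePrefix_prefix (S : List α) (k : ℕ) : phrasePrefix S k <+: S := List.take_prefix _ _

theorem length_phrasePrefix (S : List α) (k : ℕ) : (phrasePrefix S k).length = phraseEnd S k := by
  simp [phrasePrefix, phraseEnd_le_length]

/-- The first `j` phrases can be read off from the concatenation of the first `k` by parsing it.
This gives the monotonicity that binary search needs. -/
theorem phrasePrefix_eq_of_le {S T : List α} {j k : ℕ} (hjk : j ≤ k)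
    (h : phrasePrefix S k = phrasePrefix T k) : phrasePrefix S j = phrasePrefix T j := by
  have key : ∀ S : List α, phrasePrefix S j =
      (phrasePrefix S k).take (phraseEnd (phrasePrefix S k) j) := by
    intro S
    rw [phraseEnd_of_prefix (phrasePrefix_prefix S k), length_phrasePrefix,
      min_eq_left (phraseEnd_mono S hjk), phrasePrefix, phrasePrefix, List.take_take,
      min_eq_left (phraseEnd_mono S hjk)]
  rw [key S, key T, h]

theorem phraseEnd_eq_of_phrasePrefix_eq {S T : List α} {k : ℕ}
    (h : phrasePrefix S k = phrasePrefix T k) : phraseEnd S k = phraseEnd T k := by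
  rw [← length_phrasePrefix, h, length_phrasePrefix]

theorem phraseEnd_le_length_lcp {S T : List α} {k : ℕ}
    (h : phrasePrefix S k = phrasePrefix T k) : phraseEnd S k ≤ (lcp S T).length := by
  rw [← length_phrasePrefix]
  exact (prefix_lcp (phrasePrefix_prefix S k) (h ▸ phrasePrefix_prefix T k)).length_le

theorem phraseEnd_lt_length {S T : List α} (hS : ¬ S <+: T) {k : ℕ}
    (h : phrasePrefix S k = phrasePrefix T k) : phraseEnd S k < S.length := by
  refine lt_of_le_of_ne (phraseEnd_le_length S k) fun he => hS ?_
  have := phrasePrefix_prefix T k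
  rwa [← h, phrasePrefix, he, List.take_length] at this

/-- After `k` phrases the parse of `S` has covered the common prefix. One more nonempty phrase goes
beyond it and cannot be shared. -/
theorem phrasePrefix_succ_ne {S T : List α} (hS : ¬ S <+: T) {k : ℕ}
    (hk : phraseEnd (lcp S T) k = (lcp S T).length) :
    phrasePrefix S (k + 1) ≠ phrasePrefix T (k + 1) := by
  intro h
  have h1 := phraseEnd_le_length_lcp h
  have h2 := phraseEnd_lt_length hS h
  have h3 := phraseEnd_le_succ S k
  have h4 := phraseEnd_lt_succ (S := S) (k := k) (by omega)
  rw [phraseEnd_of_prefix (lcp_prefix_left S T)] at hk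
  omega

/-- The length of the copied part of the phrase following the first `k` phrases. -/
noncomputable def nextCopyLength (S : List α) (k : ℕ) : ℕ :=
  copyLength (phrasePrefix S k) (S.drop (phraseEnd S k))

/-- If the first `k` phrases of the parses of `S` and `T` agree but the first `k + 1` phrases do
not, then the longest common prefix ends at the latest with the copied part of the next phrase. -/
theorem lcp_eq_of_phrasePrefix_succ_ne {S T : List α} (hS : ¬ S <+: T) (hT : ¬ T <+: S) {k : ℕ}
    (hk : phrasePrefix S k = phrasePrefix T k)
    (hk' : phrasePrefix S (k + 1) ≠ phrasePrefix T (k + 1)) :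
    lcp S T = lcp (S.take (phraseEnd S k + nextCopyLength S k)) T := by
  -- If Alice's next phrase matched `T` including its final symbol, greediness would force the same
  -- next phrase on `T`.
  refine lcp_eq_lcp_take fun hp => hk' ?_
  have hSl := phraseEnd_lt_length hS hk
  have hTl := phraseEnd_lt_length hT hk.symm
  have he := phraseEnd_eq_of_phrasePrefix_eq hk
  have hes : phraseEnd S (k + 1) = phraseEnd S k + nextCopyLength S k + 1 := by
    rw [phraseEnd, if_pos hSl]; rfl
  have het : phraseEnd T (k + 1) = phraseEnd S k + nextCopyLength T k + 1 := by
    rw [phraseEnd, if_pos hTl, he]; rfl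
  have heq : S.take (phraseEnd S k + nextCopyLength S k + 1) =
      T.take (phraseEnd S k + nextCopyLength S k + 1) := by
    have h1 := List.prefix_iff_eq_take.mp hp
    rw [h1, List.length_take, min_eq_left]
    rw [← hes]; exact phraseEnd_le_length _ _
  obtain ⟨c1, c2⟩ := copyLength_lt (past := phrasePrefix S k) (drop_ne_nil_of_lt hSl)
  obtain ⟨d1, d2⟩ := copyLength_lt (past := phrasePrefix T k) (drop_ne_nil_of_lt hTl)
  rw [← nextCopyLength] at c1 c2 d1 d2
  rw [phrasePrefix, phrasePrefix, hes, het]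
  rw [← he] at d1 d2
  set u := phraseEnd S k
  set c := nextCopyLength S k with hc
  set d := nextCopyLength T k with hd
  have hdrop : (S.drop u).take (c + 1) = (T.drop u).take (c + 1) := by
    rw [List.take_drop, List.take_drop, ← Nat.add_assoc, heq]
  have hdrop' : (S.drop u).take c = (T.drop u).take c := by
    have := congrArg (List.take c) hdrop
    simpa [List.take_take] using this
  have hlen : u + c + 1 ≤ T.length := by
    have := congrArg List.length heq
    rw [List.length_take, List.length_take] at this
    rw [List.length_drop] at c1
    omega
  have hcd : c ≤ d := by
    rw [hd, nextCopyLength, ← he]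
    refine le_copyLength (by rw [List.length_drop]; omega) ?_
    rw [← hk]
    show (T.drop u).take c <:+: _
    rwa [← hdrop']
  have hdc : d ≤ c := by
    by_contra hlt
    have hinf : (S.drop u).take (c + 1) <:+: phrasePrefix S k := by
      rw [hdrop, hk]
      exact (List.take_prefix_take_left (by omega)).isInfix.trans d2
    -- A longer copy contradicts the maximality of `c` unless no further symbol of `S` would follow
    -- it; in that case `hp` makes all of `S` a prefix of `T`.
    by_cases hend : c + 1 < (S.drop u).length
    · have : c + 1 ≤ c := le_copyLength hend hinf
      omega
    · rw [List.length_drop] at hend c1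
      apply hS
      rwa [List.take_of_length_le (by omega)] at hp
  rw [← le_antisymm hcd hdc]
  exact heq

/-- The copied part of a phrase is determined by a position in the prefix before the phrase. -/
theorem exists_source {S : List α} {k : ℕ} (h : phraseEnd S k < S.length) :
    ∃ p ≤ phraseEnd S k, nextCopyLength S k ≤ phraseEnd S k ∧
      S.take (phraseEnd S k + nextCopyLength S k) =
        phrasePrefix S k ++ ((phrasePrefix S k).drop p).take (nextCopyLength S k) := by
  obtain ⟨h1, h2⟩ := copyLength_lt (past := phrasePrefix S k) (drop_ne_nil_of_lt h)
  rw [← nextCopyLength] at h1 h2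
  have hlen : ((S.drop (phraseEnd S k)).take (nextCopyLength S k)).length = nextCopyLength S k := by
    rw [List.length_take]; omega
  have h3 := h2.length_le
  rw [hlen, length_phrasePrefix] at h3
  obtain ⟨x, y, hxy⟩ := h2
  refine ⟨x.length, ?_, h3, ?_⟩
  · have := congrArg List.length hxy
    rw [length_phrasePrefix] at this
    simp only [List.length_append] at this
    omega
  · rw [List.take_add]
    congr 1
    conv_rhs => rw [← hxy]
    rw [List.append_assoc, List.drop_left, List.take_append_of_le_length hlen.ge,
      List.take_of_length_le hlen.le]

end phraseEnd

/-! ### Independence of the coins and random hash functions -/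

section Coins

open MeasureTheory ProbabilityTheory
open scoped ENNReal

instance isProbabilityMeasure_coinLaw : IsProbabilityMeasure coinLaw := by
  unfold coinLaw; infer_instance

/-- The σ-algebra generated by the coins with indices in `S`. -/
@[reducible]
def coinsIn (S : Set ℕ) : MeasurableSpace Coins :=
  ⨆ i ∈ S, MeasurableSpace.comap (fun r : Coins => r i) inferInstance

theorem coinsIn_mono {S T : Set ℕ} (h : S ⊆ T) : coinsIn S ≤ coinsIn T :=
  biSup_mono h

theorem coinsIn_le (S : Set ℕ) : coinsIn S ≤ (inferInstance : MeasurableSpace Coins) :=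
  iSup₂_le fun i _ => (measurable_pi_apply i).comap_le

theorem measurable_coin {S : Set ℕ} {i : ℕ} (hi : i ∈ S) :
    Measurable[coinsIn S] fun r : Coins => r i :=
  measurable_iff_comap_le.mpr
    (le_iSup₂ (f := fun i (_ : i ∈ S) =>
      MeasurableSpace.comap (fun r : Coins => r i) inferInstance) i hi)

theorem coinLaw_inter {S T : Set ℕ} (hST : Disjoint S T) {U V : Set Coins}
    (hU : MeasurableSet[coinsIn S] U) (hV : MeasurableSet[coinsIn T] V) :
    coinLaw (U ∩ V) = coinLaw U * coinLaw V := by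
  have h1 : iIndepFun (fun (i : ℕ) (r : Coins) => r i) coinLaw :=
    iIndepFun_infinitePi (X := fun _ b => b) fun _ => measurable_id
  rw [iIndepFun_iff_iIndep] at h1
  exact (Indep_iff _ _ _).mp (indep_iSup_of_disjoint
    (fun i => (measurable_pi_apply i).comap_le) h1 hST) U V hU hV

theorem coinLaw_coin_eq (i : ℕ) (v : Bool) : coinLaw {r | r i = v} = 1 / 2 := by
  have h : coinLaw ((fun r : Coins => r i) ⁻¹' {v}) = 1 / 2 := by
    rw [← Measure.map_apply (measurable_pi_apply i) (measurableSet_singleton v), coinLaw,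
      Measure.infinitePi_map_eval, PMF.toMeasure_apply_singleton _ _ (measurableSet_singleton v)]
    simp
  exact h

theorem measurableSet_coin_eq_coin {S : Set ℕ} {p q : ℕ} (hp : p ∈ S) (hq : q ∈ S) :
    MeasurableSet[coinsIn S] {r : Coins | r p = r q} :=
  have h : Measurable[coinsIn S] fun r : Coins => (r p, r q) :=
    Measurable.prodMk (f := fun r : Coins => r p) (g := fun r => r q)
      (measurable_coin hp) (measurable_coin hq)
  h (MeasurableSet.of_discrete (s := {v : Bool × Bool | v.1 = v.2}))

theorem coinLaw_coin_eq_coin {p q : ℕ} (hpq : p ≠ q) :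
    coinLaw {r | r p = r q} = 1 / 2 := by
  have key (v : Bool) : coinLaw ({r | r p = v} ∩ {r | r q = v}) = 1 / 4 := by
    have hp : MeasurableSet[coinsIn {p}] {r : Coins | r p = v} :=
      measurable_coin (Set.mem_singleton p) (measurableSet_singleton v)
    have hq : MeasurableSet[coinsIn {q}] {r : Coins | r q = v} :=
      measurable_coin (Set.mem_singleton q) (measurableSet_singleton v)
    rw [coinLaw_inter (by simpa using hpq) hp hq,
      coinLaw_coin_eq, coinLaw_coin_eq, one_div, one_div,
      ← ENNReal.mul_inv (by simp) (by simp)]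
    norm_num
  have hset : {r : Coins | r p = r q} =
      ({r | r p = true} ∩ {r | r q = true}) ∪ ({r | r p = false} ∩ {r | r q = false}) := by
    ext r
    cases hp : r p <;> cases hq : r q <;> simp [hp, hq]
  rw [hset, measure_union, key, key]
  · rw [ENNReal.div_add_div_same, ENNReal.div_eq_div_iff] <;> norm_num
  · rw [Set.disjoint_left]
    rintro r ⟨h1, -⟩ ⟨h2, -⟩
    simp_all
  · have hm (i : ℕ) : MeasurableSet {r : Coins | r i = false} :=
      (measurable_pi_apply (X := fun _ => Bool) i) (measurableSet_singleton false)
    exact (hm p).inter (hm q)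

/-- The `j`-th bit of the hash value of `x` in the block `t` of the coins. -/
def hashBit (r : Coins) (t x j : ℕ) : Bool := r (Nat.pair t (Nat.pair j x))

/-- The first `b` bits of the hash values of `x` and `y` agree. -/
def hashAgree (b : ℕ) (r : Coins) (t x y : ℕ) : Bool :=
  decide (∀ j < b, hashBit r t x j = hashBit r t y j)

theorem hashAgree_self (b : ℕ) (r : Coins) (t x : ℕ) : hashAgree b r t x x = true := by
  simp [hashAgree]

/-- The indices of the coins of block `t`. -/
def coinBlock (t : ℕ) : Set ℕ := {i | (Nat.unpair i).1 = t}

/-- The indices of the coins of the blocks before `t`. -/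
def coinsBefore (t : ℕ) : Set ℕ := {i | (Nat.unpair i).1 < t}

theorem disjoint_coinsBefore_coinBlock (t : ℕ) : Disjoint (coinsBefore t) (coinBlock t) := by
  rw [Set.disjoint_left]
  intro i h1 h2
  simp only [coinsBefore, coinBlock, Set.mem_ofPred_eq] at h1 h2
  omega

theorem measurableSet_hash_eq (t x y j : ℕ) {S : Set ℕ}
    (hS : ∀ z, Nat.pair t (Nat.pair j z) ∈ S) :
    MeasurableSet[coinsIn S] {r : Coins | hashBit r t x j = hashBit r t y j} :=
  measurableSet_coin_eq_coin (hS x) (hS y)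

theorem setOf_hashAgree_succ (b t x y : ℕ) : {r | hashAgree (b + 1) r t x y = true} =
    {r | hashAgree b r t x y = true} ∩ {r | hashBit r t x b = hashBit r t y b} := by
  ext r
  simp only [hashAgree, decide_eq_true_eq, Set.mem_ofPred_eq, Set.mem_inter_iff]
  exact Nat.forall_lt_succ_right

theorem measurableSet_hashAgree (b t x y : ℕ) {S : Set ℕ}
    (hS : ∀ j < b, ∀ z, Nat.pair t (Nat.pair j z) ∈ S) :
    MeasurableSet[coinsIn S] {r : Coins | hashAgree b r t x y = true} := by
  induction b with
  | zero => simp [hashAgree]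
  | succ b ih =>
    rw [setOf_hashAgree_succ]
    exact @MeasurableSet.inter _ (coinsIn S) _ _ (ih fun j hj => hS j (by omega))
      (measurableSet_hash_eq t x y b (hS b (by omega)))

/-- Hash bits with different indices use disjoint sets of coins, and at each index the two inputs
read two different coins, which agree with probability `1 / 2`. -/
theorem coinLaw_hashAgree (b t : ℕ) {x y : ℕ} (hxy : x ≠ y) :
    coinLaw {r | hashAgree b r t x y = true} = (1 / 2) ^ b := by
  induction b with
  | zero => simp [hashAgree]
  | succ b ih =>
    rw [setOf_hashAgree_succ, coinLaw_inter
      (S := {i | (Nat.unpair (Nat.unpair i).2).1 < b}) (T := {i | (Nat.unpair (Nat.unpair i).2).1 = b})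
      ?_ (measurableSet_hashAgree b t x y (by simp)) (measurableSet_hash_eq t x y b (by simp)), ih,
      pow_succ]
    · congr 1
      exact coinLaw_coin_eq_coin (by simpa [Nat.pair_eq_pair] using hxy)
    · rw [Set.disjoint_left]
      intro i h1 h2
      simp only [Set.mem_ofPred_eq] at h1 h2
      omega

theorem measurable_hashAgree (b t x y : ℕ) :
    Measurable[coinsIn (coinBlock t)] fun r => hashAgree b r t x y :=
  @measurable_to_bool _ (coinsIn (coinBlock t)) _
    (measurableSet_hashAgree b t x y (by simp [coinBlock]))

/-- An event that depends on fresh coins and on a random variable determined by other coins. -/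
theorem coinLaw_adaptive_le {σ : Type*} [Countable σ] {S T : Set ℕ} (hST : Disjoint S T)
    {W : Coins → σ} (hW : ∀ s, MeasurableSet[coinsIn S] {r | W r = s}) {V : σ → Set Coins}
    (hV : ∀ s, MeasurableSet[coinsIn T] (V s)) {δ : ℝ≥0∞} (hδ : ∀ s, coinLaw (V s) ≤ δ) :
    coinLaw {r | r ∈ V (W r)} ≤ δ := by
  have hset : {r | r ∈ V (W r)} = ⋃ s, {r | W r = s} ∩ V s := by
    ext r; simp
  have hsum : ∑' s, coinLaw {r | W r = s} ≤ 1 := by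
    rw [← measure_iUnion]
    · exact prob_le_one
    · intro s s' hss
      rw [Function.onFun, Set.disjoint_left]
      rintro r h1 h2
      exact hss (h1.symm.trans h2)
    · exact fun s => coinsIn_le S _ (hW s)
  calc coinLaw {r | r ∈ V (W r)} ≤ ∑' s, coinLaw ({r | W r = s} ∩ V s) := by
        rw [hset]; exact measure_iUnion_le _
    _ = ∑' s, coinLaw {r | W r = s} * coinLaw (V s) :=
        tsum_congr fun s => coinLaw_inter hST (hW s) (hV s)
    _ ≤ ∑' s, coinLaw {r | W r = s} * δ := ENNReal.tsum_le_tsum fun s => by gcongr; exact hδ s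
    _ ≤ 1 * δ := by rw [ENNReal.tsum_mul_right]; gcongr
    _ = δ := one_mul δ

end Coins

/-! ### Binary search with unreliable comparisons -/

/-- The lower end of the current search interval; the stack holds the lower ends accepted so far. -/
def searchLo (s : List ℕ × ℕ) : ℕ := s.1.headD 0

/-- The midpoint of the current search interval. -/
def searchMid (s : List ℕ × ℕ) : ℕ := (searchLo s + s.2) / 2

/-- A step of the search: `u` and `v` tell whether the lower end and the midpoint pass the test. If
the lower end fails, it becomes the upper end, and the previous lower end is restored. -/
def searchStep (u v : Bool) : List ℕ × ℕ → List ℕ × ℕ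
  | ([], hi) => ([], hi)
  | (lo :: stk, hi) =>
    if u = false then (stk, lo)
    else if hi ≤ lo + 1 then (lo :: stk, hi)
    else if v then ((lo + hi) / 2 :: lo :: stk, hi)
    else (lo :: stk, (lo + hi) / 2)

/-- The stack is strictly decreasing down to its first entry satisfying `f`, and such an entry
exists. -/
def SearchValid (f : ℕ → Prop) : List ℕ → ℕ → Prop
  | [], _ => False
  | lo :: stk, hi => lo < hi ∧ (f lo ∨ SearchValid f stk lo)

open Classical in
/-- The number of steps of the search that remain if no further error occurs. -/
noncomputable def searchDist (f : ℕ → Prop) : List ℕ → ℕ → ℕ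
  | [], _ => 0
  | lo :: stk, hi => if f lo then Nat.clog 2 (hi - lo) else searchDist f stk lo + 1

section Search

variable {f : ℕ → Prop}

theorem clog_half_lt {n k : ℕ} (hn : 2 ≤ n) (hk : k ≤ (n + 1) / 2) :
    Nat.clog 2 k + 1 ≤ Nat.clog 2 n := by
  rw [Nat.clog_of_two_le one_lt_two hn]
  have : (n + 2 - 1) / 2 = (n + 1) / 2 := by congr 1
  rw [this]
  exact Nat.add_le_add_right (Nat.clog_mono_right 2 hk) 1

/-- The potential `searchDist` drops by one in a correct step until it is zero, rises by at most one
in any step, and stays at zero once there: a true lower end always passes its test, and an interval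
of length one is not split. The upper end never satisfies `f`, because a failed test is always
right. -/
theorem searchStep_spec (hf : Antitone f) {u v : Bool} {s : List ℕ × ℕ}
    (hs : SearchValid f s.1 s.2) (hhi : ¬ f s.2) (hu : f (searchLo s) → u = true)
    (hv : f (searchMid s) → v = true) :
    SearchValid f (searchStep u v s).1 (searchStep u v s).2 ∧ ¬ f (searchStep u v s).2 ∧
    (searchStep u v s).2 ≤ s.2 ∧
    (searchDist f s.1 s.2 = 0 → searchDist f (searchStep u v s).1 (searchStep u v s).2 = 0) ∧
    searchDist f (searchStep u v s).1 (searchStep u v s).2 ≤ searchDist f s.1 s.2 + 1 ∧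
    ((u = true → f (searchLo s)) → (v = true → f (searchMid s)) →
      searchDist f (searchStep u v s).1 (searchStep u v s).2 ≤ searchDist f s.1 s.2 - 1) := by
  obtain ⟨_ | ⟨lo, stk⟩, hi⟩ := s
  · exact hs.elim
  obtain ⟨hlt, hval⟩ := hs
  simp only [searchLo, searchMid, List.headD_cons] at hu hv hhi ⊢
  by_cases hflo : f lo
  · have hu' := hu hflo
    subst hu'
    by_cases hleaf : hi ≤ lo + 1
    · have : hi - lo ≤ 1 := by omega
      simp [searchStep, hleaf, SearchValid, hlt, hflo, hhi, searchDist,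
        Nat.clog_of_right_le_one this]
    · have hmid1 : lo < (lo + hi) / 2 := by omega
      have hmid2 : (lo + hi) / 2 < hi := by omega
      have h1 := clog_half_lt (n := hi - lo) (k := hi - (lo + hi) / 2) (by omega) (by omega)
      have h2 := clog_half_lt (n := hi - lo) (k := (lo + hi) / 2 - lo) (by omega) (by omega)
      by_cases hfm : f ((lo + hi) / 2)
      · have hv' := hv hfm
        subst hv'
        have hV : SearchValid f ((lo + hi) / 2 :: lo :: stk) hi := ⟨hmid2, .inl hfm⟩
        simp [searchStep, hleaf, hflo, hhi, searchDist, hfm, hV]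
        omega
      · cases v
        · have hV : SearchValid f (lo :: stk) ((lo + hi) / 2) := ⟨hmid1, .inl hflo⟩
          simp [searchStep, hleaf, hflo, searchDist, hfm, hV]
          omega
        · have hV : SearchValid f ((lo + hi) / 2 :: lo :: stk) hi :=
            ⟨hmid2, .inr ⟨hmid1, .inl hflo⟩⟩
          simp [searchStep, hleaf, hflo, hhi, searchDist, hfm, hV]
          omega
  · have hval' := hval.resolve_left hflo
    cases u
    · simp only [searchStep, hflo, searchDist]
      simp [hval', hflo]
      omega
    · by_cases hleaf : hi ≤ lo + 1
      · simp [searchStep, hleaf, SearchValid, hlt, hflo, hhi, searchDist, hval']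
      · have hmid1 : lo < (lo + hi) / 2 := by omega
        have hmid2 : (lo + hi) / 2 < hi := by omega
        have hfm : ¬ f ((lo + hi) / 2) := fun h => hflo (hf hmid1.le h)
        cases v
        · simp [searchStep, hleaf, SearchValid, hflo, searchDist, hfm, hmid1, hval', hmid2.le]
        · simp [searchStep, hleaf, SearchValid, hflo, hhi, searchDist, hfm, hmid1, hmid2, hval']

/-- The search on the interval from `0` to `H`, where `T t k` is the result of testing `k` in step
`t`. -/
def searchRun (T : ℕ → ℕ → Bool) (H : ℕ) : ℕ → List ℕ × ℕ
  | 0 => ([0], H)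
  | t + 1 => searchStep (T t (searchLo (searchRun T H t))) (T t (searchMid (searchRun T H t)))
      (searchRun T H t)

/-- In state `s`, one of the two tests wrongly succeeds. -/
def SearchError (f : ℕ → Prop) (T : ℕ → Bool) (s : List ℕ × ℕ) : Prop :=
  (T (searchLo s) = true ∧ ¬ f (searchLo s)) ∨ (T (searchMid s) = true ∧ ¬ f (searchMid s))

open Classical in
/-- The number of errors in the first `n` steps of the search. -/
noncomputable def searchErrors (f : ℕ → Prop) (T : ℕ → ℕ → Bool) (H n : ℕ) : ℕ :=
  ∑ t ∈ Finset.range n, if SearchError f (T t) (searchRun T H t) then 1 else 0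

theorem searchRun_spec (hf : Antitone f) {T : ℕ → ℕ → Bool} (hT : ∀ t k, f k → T t k = true)
    {H : ℕ} (h0 : f 0) (hH : ¬ f H) (n : ℕ) :
    SearchValid f (searchRun T H n).1 (searchRun T H n).2 ∧ ¬ f (searchRun T H n).2 ∧
    (searchRun T H n).2 ≤ H ∧
    (searchDist f (searchRun T H n).1 (searchRun T H n).2 = 0 ∨
      searchDist f (searchRun T H n).1 (searchRun T H n).2 + n ≤
        Nat.clog 2 H + 2 * searchErrors f T H n) := by
  classical
  induction n with
  | zero =>
    have : 0 < H := Nat.pos_of_ne_zero fun h => hH (h ▸ h0)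
    simp [searchRun, SearchValid, h0, hH, this, searchDist, searchErrors]
  | succ n ih =>
    obtain ⟨i1, i2, i3, i4⟩ := ih
    obtain ⟨s1, s2, s3, s4, s5, s6⟩ := searchStep_spec hf i1 i2 (hT n _) (hT n _)
    refine ⟨s1, s2, s3.trans i3, ?_⟩
    rcases i4 with i4 | i4
    · exact .inl (s4 i4)
    by_cases hz : searchDist f (searchRun T H n).1 (searchRun T H n).2 = 0
    · exact .inl (s4 hz)
    right
    rw [searchErrors, Finset.sum_range_succ, ← searchErrors]
    by_cases he : SearchError f (T n) (searchRun T H n)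
    · rw [if_pos he]
      rw [searchRun]
      omega
    · rw [if_neg he]
      simp only [SearchError, not_or, not_and, not_not] at he
      have := s6 he.1 he.2
      rw [searchRun]
      omega

theorem searchRun_correct (hf : Antitone f) {T : ℕ → ℕ → Bool} (hT : ∀ t k, f k → T t k = true)
    {m : ℕ} (h0 : f 0) (hH : ¬ f (2 ^ m)) (he : m = 0 ∨ searchErrors f T (2 ^ m) (3 * m) < m) :
    ∃ lo stk, searchRun T (2 ^ m) (3 * m) = (lo :: stk, lo + 1) ∧ f lo ∧ ¬ f (lo + 1) ∧
      lo < 2 ^ m := by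
  obtain ⟨h1, h2, h3, h4⟩ := searchRun_spec hf hT h0 hH (3 * m)
  rw [Nat.clog_pow 2 m one_lt_two] at h4
  have hD : searchDist f (searchRun T (2 ^ m) (3 * m)).1 (searchRun T (2 ^ m) (3 * m)).2 = 0 := by
    rcases he with rfl | he
    · simp [searchRun, searchDist, h0]
    -- With fewer than `m` errors, a positive potential after `3 * m` steps would contradict
    -- potential `+ 3 * m ≤ m + 2 * (m - 1)`.
    · omega
  generalize searchRun T (2 ^ m) (3 * m) = s at *
  obtain ⟨stk, hi⟩ := s
  cases stk with
  | nil => exact h1.elim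
  | cons lo stk =>
    simp only [searchDist] at hD
    split_ifs at hD with hlo
    have hle : hi - lo ≤ 1 := by
      by_contra hgt
      have := Nat.clog_pos one_lt_two (n := hi - lo) (by omega)
      omega
    have := h1.1
    obtain rfl : hi = lo + 1 := by omega
    exact ⟨lo, stk, rfl, hlo, h2, by simp only at h3; omega⟩

end Search

/-! ### The search with random hash functions -/

section HashSearch

open MeasureTheory
open scoped ENNReal

variable (b : ℕ) (xs ys : ℕ → ℕ)

/-- The hash tests of the search for the last index at which two sequences agree. -/
def hashTest (r : Coins) (t k : ℕ) : Bool := hashAgree b r t (xs k) (ys k)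

/-- The state before step `t` uses only earlier coin blocks, so the hash functions of step `t` are
fresh even though the tested indices are chosen adaptively. -/
theorem measurableSet_searchRun_eq (H t : ℕ) (s : List ℕ × ℕ) :
    MeasurableSet[coinsIn (coinsBefore t)] {r | searchRun (hashTest b xs ys r) H t = s} := by
  induction t generalizing s with
  | zero => exact @MeasurableSet.const _ (coinsIn _) (([0], H) = s)
  | succ t ih =>
    have hset : {r | searchRun (hashTest b xs ys r) H (t + 1) = s} =
        ⋃ s', {r | searchRun (hashTest b xs ys r) H t = s'} ∩
          {r | searchStep (hashTest b xs ys r t (searchLo s'))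
            (hashTest b xs ys r t (searchMid s')) s' = s} := by
      ext r; simp [searchRun]
    rw [hset]
    refine @MeasurableSet.iUnion _ _ (coinsIn _) _ _ fun s' => ?_
    refine @MeasurableSet.inter _ (coinsIn _) _ _ ?_ ?_
    · refine coinsIn_mono ?_ _ (ih s')
      intro i hi
      simp only [coinsBefore, Set.mem_ofPred_eq] at hi ⊢
      omega
    · have hle : coinsIn (coinBlock t) ≤ coinsIn (coinsBefore (t + 1)) := by
        refine coinsIn_mono ?_
        intro i hi
        simp only [coinsBefore, coinBlock, Set.mem_ofPred_eq] at hi ⊢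
        omega
      refine hle _ ?_
      have hm : Measurable[coinsIn (coinBlock t)] fun r =>
          (hashTest b xs ys r t (searchLo s'), hashTest b xs ys r t (searchMid s')) :=
        Measurable.prodMk (f := fun r => hashTest b xs ys r t (searchLo s'))
          (g := fun r => hashTest b xs ys r t (searchMid s'))
          (measurable_hashAgree b t _ _) (measurable_hashAgree b t _ _)
      exact hm (MeasurableSet.of_discrete (s := {p : Bool × Bool | searchStep p.1 p.2 s' = s}))

theorem measurableSet_wrongTest (t k : ℕ) : MeasurableSet[coinsIn (coinBlock t)]
    {r | hashTest b xs ys r t k = true ∧ ¬ xs k = ys k} :=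
  @MeasurableSet.inter _ (coinsIn (coinBlock t)) _ _
    (measurableSet_hashAgree b t _ _ (by simp [coinBlock]))
    (@MeasurableSet.const _ (coinsIn (coinBlock t)) (¬ xs k = ys k))

theorem coinLaw_wrongTest_le (t k : ℕ) :
    coinLaw {r | hashTest b xs ys r t k = true ∧ ¬ xs k = ys k} ≤ (1 / 2) ^ b := by
  by_cases h : xs k = ys k
  · simp [h]
  · refine (measure_mono fun r hr => ?_).trans (coinLaw_hashAgree b t h).le
    exact hr.1

theorem measurableSet_searchError (t : ℕ) (s : List ℕ × ℕ) : MeasurableSet[coinsIn (coinBlock t)]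
    {r | SearchError (fun k => xs k = ys k) (hashTest b xs ys r t) s} :=
  @MeasurableSet.union _ (coinsIn (coinBlock t)) _ _
    (measurableSet_wrongTest b xs ys t _) (measurableSet_wrongTest b xs ys t _)

theorem coinLaw_searchError_le (H t : ℕ) :
    coinLaw {r | SearchError (fun k => xs k = ys k) (hashTest b xs ys r t)
      (searchRun (hashTest b xs ys r) H t)} ≤ 2 * (1 / 2) ^ b := by
  refine coinLaw_adaptive_le (disjoint_coinsBefore_coinBlock t)
    (measurableSet_searchRun_eq b xs ys H t) (measurableSet_searchError b xs ys t) fun s => ?_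
  refine (measure_union_le _ _).trans ?_
  rw [two_mul]
  exact add_le_add (coinLaw_wrongTest_le b xs ys t _) (coinLaw_wrongTest_le b xs ys t _)

theorem measurableSet_searchError_searchRun (H t : ℕ) :
    MeasurableSet {r | SearchError (fun k => xs k = ys k) (hashTest b xs ys r t)
      (searchRun (hashTest b xs ys r) H t)} := by
  have hset : {r | SearchError (fun k => xs k = ys k) (hashTest b xs ys r t)
      (searchRun (hashTest b xs ys r) H t)} =
      ⋃ s, {r | searchRun (hashTest b xs ys r) H t = s} ∩
        {r | SearchError (fun k => xs k = ys k) (hashTest b xs ys r t) s} := by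
    ext r; simp
  rw [hset]
  exact MeasurableSet.iUnion fun s => MeasurableSet.inter
    (coinsIn_le _ _ (measurableSet_searchRun_eq b xs ys H t s))
    (coinsIn_le _ _ (measurableSet_searchError b xs ys t s))

/-- Markov's inequality: the expected number of errors in `3 * m` steps is at most `3 * m * 2 * (1 /
2) ^ b`, and the threshold `m` cancels. Independence of the errors is not needed. -/
theorem coinLaw_searchErrors_le {m : ℕ} (hm : 0 < m) (H : ℕ) :
    coinLaw {r | m ≤ searchErrors (fun k => xs k = ys k) (hashTest b xs ys r) H (3 * m)} ≤
      6 * (1 / 2) ^ b := by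
  classical
  set E : ℕ → Set Coins := fun t => {r | SearchError (fun k => xs k = ys k) (hashTest b xs ys r t)
      (searchRun (hashTest b xs ys r) H t)} with hE
  have hEm (t : ℕ) : MeasurableSet (E t) := measurableSet_searchError_searchRun b xs ys H t
  let g : Coins → ℝ≥0∞ := fun r => ∑ t ∈ Finset.range (3 * m), (E t).indicator 1 r
  have hg (r : Coins) : g r =
      (searchErrors (fun k => xs k = ys k) (hashTest b xs ys r) H (3 * m) : ℕ) := by
    simp only [g, searchErrors, Nat.cast_sum, Set.indicator_apply, Nat.cast_ite, Pi.one_apply,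
      Nat.cast_one, Nat.cast_zero, hE, Set.mem_ofPred_eq]
  have hgm : Measurable g :=
    Finset.measurable_sum _ fun t _ => measurable_one.indicator (hEm t)
  have hint : ∫⁻ r, g r ∂coinLaw ≤ m * (6 * (1 / 2) ^ b) := by
    rw [lintegral_finsetSum _ fun t _ => measurable_one.indicator (hEm t)]
    calc ∑ t ∈ Finset.range (3 * m), ∫⁻ r, (E t).indicator 1 r ∂coinLaw
        ≤ ∑ _t ∈ Finset.range (3 * m), 2 * (1 / 2 : ℝ≥0∞) ^ b := by
          refine Finset.sum_le_sum fun t _ => ?_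
          rw [lintegral_indicator_one (hEm t)]
          exact coinLaw_searchError_le b xs ys H t
      _ = m * (6 * (1 / 2) ^ b) := by
          rw [Finset.sum_const, Finset.card_range, nsmul_eq_mul]
          push_cast
          ring
  have hm0 : (m : ℝ≥0∞) ≠ 0 := by exact_mod_cast hm.ne'
  have hmark := mul_meas_ge_le_lintegral (μ := coinLaw) hgm m
  have hset : {r | (m : ℝ≥0∞) ≤ g r} =
      {r | m ≤ searchErrors (fun k => xs k = ys k) (hashTest b xs ys r) H (3 * m)} := by
    ext r
    simp only [Set.mem_ofPred_eq, hg, Nat.cast_le]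
  rw [hset] at hmark
  exact (ENNReal.mul_le_mul_iff_right hm0 (ENNReal.natCast_ne_top m)).mp (hmark.trans hint)

/-- With high probability, the search finds the last index at which the sequences agree. -/
theorem coinLaw_search_fails_le (hanti : Antitone fun k => xs k = ys k) (h0 : xs 0 = ys 0)
    {m : ℕ} (hH : xs (2 ^ m) ≠ ys (2 ^ m)) :
    coinLaw {r | ¬ ∃ lo stk, searchRun (hashTest b xs ys r) (2 ^ m) (3 * m) = (lo :: stk, lo + 1) ∧
      xs lo = ys lo ∧ xs (lo + 1) ≠ ys (lo + 1) ∧ lo < 2 ^ m} ≤ 6 * (1 / 2) ^ b := by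
  have hT (r : Coins) (t k : ℕ) (h : xs k = ys k) : hashTest b xs ys r t k = true := by
    rw [hashTest, h, hashAgree_self]
  rcases Nat.eq_zero_or_pos m with hm | hm
  · refine (measure_mono_null (t := ∅) (fun r hr => ?_) measure_empty).le.trans zero_le
    exact hr (searchRun_correct hanti (hT r) h0 hH (.inl hm))
  · refine (measure_mono fun r hr => ?_).trans (coinLaw_searchErrors_le b xs ys hm (2 ^ m))
    by_contra hlt
    exact hr (searchRun_correct hanti (hT r) h0 hH (.inr (not_le.mp hlt)))

end HashSearch

/-! ### Composing steps of block protocols -/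

namespace BlockProtocol

theorem Finishes.of_advance {X Y O : Type*} {M : BlockProtocol X Y O} {r : Coins} {x : X} {y : Y}
    {s s' : M.State} (hs : M.output s = none) (hadv : M.advance r x y s = s') {n c : ℕ} {o : O}
    (h : M.Finishes r x y s' n c o) : M.Finishes r x y s (n + 1) (c + 2 * M.width s) o := by
  subst hadv
  exact .step hs h

/-- Consecutive steps from states of the same width. -/
theorem Finishes.of_steps {X Y O : Type*} {M : BlockProtocol X Y O} {r : Coins} {x : X} {y : Y}
    (s : ℕ → M.State) (n w : ℕ) (hout : ∀ i < n, M.output (s i) = none)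
    (hadv : ∀ i < n, M.advance r x y (s i) = s (i + 1)) (hw : ∀ i < n, M.width (s i) = w)
    {a c : ℕ} {o : O} (h : M.Finishes r x y (s n) a c o) :
    M.Finishes r x y (s 0) (a + n) (c + n * (2 * w)) o := by
  induction n generalizing s with
  | zero => simpa using h
  | succ n ih =>
    have h1 := ih (fun i => s (i + 1)) (fun i hi => hout _ (by omega))
      (fun i hi => hadv _ (by omega)) (fun i hi => hw _ (by omega)) h
    have h2 := Finishes.step (hout 0 (by omega)) (by rw [hadv 0 (by omega)]; exact h1)
    rw [hw 0 (by omega)] at h2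
    convert h2 using 1 <;> ring

end BlockProtocol

/-! ### The protocol -/

/-- The number with the first `w` bits of a sequence as binary digits. -/
def decodeBits (w : ℕ) (f : ℕ → Bool) : ℕ := Nat.ofBits fun i : Fin w => f i

theorem decodeBits_testBit {w n : ℕ} (h : n < 2 ^ w) {f : ℕ → Bool}
    (hf : ∀ i < w, f i = n.testBit i) : decodeBits w f = n := by
  have : (fun i : Fin w => f i) = fun i : Fin w => n.testBit i := funext fun i => hf i i.2
  rw [decodeBits, this, Nat.ofBits_testBit, Nat.mod_eq_of_lt h]

/-- The first `b` bits of two sequences agree. -/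
def bitsAgree (b : ℕ) (f g : ℕ → Bool) : Bool := decide (∀ i < b, f i = g i)

theorem bitsAgree_congr {b : ℕ} {f f' g g' : ℕ → Bool} (hf : ∀ i < b, f i = f' i)
    (hg : ∀ i < b, g i = g' i) : bitsAgree b f g = bitsAgree b f' g' := by
  unfold bitsAgree
  congr 1
  refine propext (forall₂_congr fun i hi => ?_)
  rw [hf i hi, hg i hi]

/-- The states of the protocol for the longest common prefix. The number of common phrases is first
bounded by a power of two (`expand`) and then found by binary search (`search`). Alice then sends
the magnitude of the length of the common phrases (`magnitude`) and the source of her next phrase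
(`source`), and Bob answers (`answer`). -/
inductive LcpState where
  | expand (j : ℕ)
  | search (m t : ℕ) (s : List ℕ × ℕ)
  | magnitude (k e : ℕ)
  | source (k e : ℕ)
  | answer (k e p l : ℕ)
  | done (o : ℕ)

namespace LcpState

/-- The output in a final state. -/
def output : LcpState → Option ℕ
  | done o => some o
  | _ => none

/-- The number of bits that each party sends in a state. -/
def width (b : ℕ) : LcpState → ℕ
  | expand _ => b + 1
  | search _ _ _ => b + b + 1
  | magnitude _ _ => 1
  | source _ e => 2 ^ e + 2 ^ e
  | answer _ e _ _ => 2 ^ e + 1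
  | done _ => 1

theorem width_pos (b : ℕ) (s : LcpState) : 0 < s.width b := by
  cases s <;> simp [width]

/-- The next state after Alice's message `f` and Bob's message `g`. -/
def next (b : ℕ) : LcpState → (ℕ → Bool) → (ℕ → Bool) → LcpState
  | expand j, f, g =>
    if bitsAgree b f g = true ∧ f b = false then expand (j + 1) else search j 0 ([0], 2 ^ j)
  | search m t s, f, g =>
    if t < 3 * m then
      search m (t + 1)
        (searchStep (bitsAgree b f g) (bitsAgree b (fun i => f (b + i)) fun i => g (b + i)) s)
    else magnitude (searchLo s) 0
  | magnitude k e, f, _ => if f 0 then source k e else magnitude k (e + 1)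
  | source k e, f, _ =>
    answer k e (decodeBits (2 ^ e) f) (decodeBits (2 ^ e) fun i => f (2 ^ e + i))
  | answer _ e _ _, _, g => done (decodeBits (2 ^ e + 1) g)
  | done o, _, _ => done o

end LcpState

section LcpProtocol

open LcpState

variable {X β : Type*}

/-- A position at which the copied part of the phrase after the first `k` phrases occurs. -/
noncomputable def sourcePos (S : List β) (k : ℕ) : ℕ :=
  Classical.epsilon fun p => p ≤ phraseEnd S k ∧ nextCopyLength S k ≤ phraseEnd S k ∧
    S.take (phraseEnd S k + nextCopyLength S k) =
      phrasePrefix S k ++ ((phrasePrefix S k).drop p).take (nextCopyLength S k)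

theorem sourcePos_spec {S : List β} {k : ℕ} (h : phraseEnd S k < S.length) :
    sourcePos S k ≤ phraseEnd S k ∧ nextCopyLength S k ≤ phraseEnd S k ∧
      S.take (phraseEnd S k + nextCopyLength S k) = phrasePrefix S k ++
        ((phrasePrefix S k).drop (sourcePos S k)).take (nextCopyLength S k) :=
  Classical.epsilon_spec (exists_source h)

/-- The common prefix length as computed by Bob with string `T` if `p` and `l` describe the source
of Alice's next phrase. -/
noncomputable def lcpAnswer (T : List β) (k p l : ℕ) : ℕ :=
  (lcp (phrasePrefix T k ++ ((phrasePrefix T k).drop p).take l) T).length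

/-- The code of the first `k` phrases. -/
noncomputable def phraseCode (code : List β → ℕ) (S : List β) (k : ℕ) : ℕ :=
  code (phrasePrefix S k)

/-- Alice's messages. -/
noncomputable def aliceLcpMsg (b : ℕ) (code : List β → ℕ) (r : Coins) (S : List β) :
    LcpState → ℕ → Bool
  | expand j, i =>
    if i < b then hashBit r j (phraseCode code S (2 ^ j)) i
    else decide (phraseEnd S (2 ^ j) = S.length)
  | search _ t s, i =>
    if i < b then hashBit r t (phraseCode code S (searchLo s)) i
    else hashBit r t (phraseCode code S (searchMid s)) (i - b)
  | magnitude k e, _ => decide (phraseEnd S k < 2 ^ 2 ^ e)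
  | source k e, i =>
    if i < 2 ^ e then (sourcePos S k).testBit i else (nextCopyLength S k).testBit (i - 2 ^ e)
  | answer _ _ _ _, _ => false
  | done _, _ => false

/-- Bob's messages. -/
noncomputable def bobLcpMsg (b : ℕ) (code : List β → ℕ) (r : Coins) (T : List β) :
    LcpState → ℕ → Bool
  | expand j, i => hashBit r j (phraseCode code T (2 ^ j)) i
  | search _ t s, i =>
    if i < b then hashBit r t (phraseCode code T (searchLo s)) i
    else hashBit r t (phraseCode code T (searchMid s)) (i - b)
  | answer k _ p l, i => (lcpAnswer T k p l).testBit i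
  | _, _ => false

theorem measurable_hashBit (t x j : ℕ) : Measurable fun r => hashBit r t x j :=
  measurable_pi_apply (X := fun _ => Bool) _

/-- The protocol for the length of the longest common prefix of `f x` and `g y`. -/
noncomputable def lcpProtocol (b : ℕ) (code : List β → ℕ) (f g : X → List β) :
    BlockProtocol X X ℕ where
  State := LcpState
  start := expand 0
  output := LcpState.output
  width := LcpState.width b
  width_pos := LcpState.width_pos b
  next := LcpState.next b
  aliceMsg r x := aliceLcpMsg b code r (f x)
  bobMsg r y := bobLcpMsg b code r (g y)
  measurable_aliceMsg x s i := by
    cases s <;> simp only [aliceLcpMsg] <;> (try split_ifs) <;>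
      first
        | exact measurable_const
        | exact measurable_hashBit _ _ _
  measurable_bobMsg y s i := by
    cases s <;> simp only [bobLcpMsg] <;> (try split_ifs) <;>
      first
        | exact measurable_const
        | exact measurable_hashBit _ _ _

variable (b : ℕ) (code : List β → ℕ) (f g : X → List β) (r : Coins) (x y : X)

theorem advance_lcpProtocol (s : LcpState) :
    (lcpProtocol b code f g).advance r x y s = LcpState.next b s
      (maskBits (s.width b) (aliceLcpMsg b code r (f x) s))
      (maskBits (s.width b) (bobLcpMsg b code r (g y) s)) := rfl

/-- Alice's extra bit reports that her string is exhausted. It ends the expansion even if hashes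
collide forever. -/
theorem advance_expand (j : ℕ) :
    (lcpProtocol b code f g).advance r x y (expand j) =
      if hashTest b (phraseCode code (f x)) (phraseCode code (g y)) r j (2 ^ j) = true ∧
        phraseEnd (f x) (2 ^ j) ≠ (f x).length then expand (j + 1)
      else search j 0 ([0], 2 ^ j) := by
  have h : bitsAgree b (maskBits (b + 1) (aliceLcpMsg b code r (f x) (expand j)))
      (maskBits (b + 1) (bobLcpMsg b code r (g y) (expand j))) =
      hashTest b (phraseCode code (f x)) (phraseCode code (g y)) r j (2 ^ j) := by
    refine bitsAgree_congr (fun i hi => ?_) fun i hi => ?_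
    · simp [maskBits, aliceLcpMsg, hi, Nat.lt_succ_of_lt hi]
    · simp [maskBits, bobLcpMsg, Nat.lt_succ_of_lt hi]
  have h' : maskBits (b + 1) (aliceLcpMsg b code r (f x) (expand j)) b = false ↔
      phraseEnd (f x) (2 ^ j) ≠ (f x).length := by
    simp [maskBits, aliceLcpMsg]
  simp only [advance_lcpProtocol, LcpState.width, LcpState.next, h, h']
  rfl

theorem advance_search {m t : ℕ} (ht : t < 3 * m) (s : List ℕ × ℕ) :
    (lcpProtocol b code f g).advance r x y (search m t s) = search m (t + 1)
      (searchStep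
        (hashTest b (phraseCode code (f x)) (phraseCode code (g y)) r t (searchLo s))
        (hashTest b (phraseCode code (f x)) (phraseCode code (g y)) r t (searchMid s)) s) := by
  simp only [advance_lcpProtocol, LcpState.width, LcpState.next, if_pos ht]
  congr 2
  · refine bitsAgree_congr (fun i hi => ?_) fun i hi => ?_
    · simp [maskBits, aliceLcpMsg, hi, show i < b + b + 1 by omega]
    · simp [maskBits, bobLcpMsg, hi, show i < b + b + 1 by omega]
  · refine bitsAgree_congr (fun i hi => ?_) fun i hi => ?_
    · simp [maskBits, aliceLcpMsg, show b + i < b + b + 1 by omega]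
    · simp [maskBits, bobLcpMsg, show b + i < b + b + 1 by omega]

theorem advance_search_last (m : ℕ) (s : List ℕ × ℕ) :
    (lcpProtocol b code f g).advance r x y (search m (3 * m) s) = magnitude (searchLo s) 0 := by
  simp only [advance_lcpProtocol, LcpState.next, lt_irrefl, if_false]
  rfl

theorem advance_magnitude (k e : ℕ) :
    (lcpProtocol b code f g).advance r x y (magnitude k e) =
      if phraseEnd (f x) k < 2 ^ 2 ^ e then source k e else magnitude k (e + 1) := by
  simp [advance_lcpProtocol, LcpState.width, LcpState.next, maskBits, aliceLcpMsg]
  rfl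

theorem advance_source {k e : ℕ} (h1 : sourcePos (f x) k < 2 ^ 2 ^ e)
    (h2 : nextCopyLength (f x) k < 2 ^ 2 ^ e) :
    (lcpProtocol b code f g).advance r x y (source k e) =
      answer k e (sourcePos (f x) k) (nextCopyLength (f x) k) := by
  simp only [advance_lcpProtocol, LcpState.width, LcpState.next]
  congr 1
  · refine decodeBits_testBit h1 fun i hi => ?_
    simp [maskBits, aliceLcpMsg, hi, show i < 2 ^ e + 2 ^ e by omega]
  · refine decodeBits_testBit h2 fun i hi => ?_
    simp [maskBits, aliceLcpMsg, hi]

theorem advance_answer {k e p l : ℕ} (h : lcpAnswer (g y) k p l < 2 ^ (2 ^ e + 1)) :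
    (lcpProtocol b code f g).advance r x y (answer k e p l) = done (lcpAnswer (g y) k p l) := by
  simp only [advance_lcpProtocol, LcpState.width, LcpState.next]
  congr 1
  refine decodeBits_testBit h fun i hi => ?_
  simp [maskBits, bobLcpMsg, hi]

end LcpProtocol

/-! ### Complete executions of the protocol -/

section LcpProtocol

open LcpState

variable {X β : Type*} {b : ℕ} {code : List β → ℕ} {f g : X → List β} {r : Coins} {x y : X}

theorem exists_lt_two_pow_two_pow (n : ℕ) : ∃ e, n < 2 ^ 2 ^ e :=
  ⟨n, Nat.lt_two_pow_self.trans Nat.lt_two_pow_self⟩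

/-- The least `e` with `n < 2 ^ 2 ^ e`. -/
def magnitudeOf (n : ℕ) : ℕ := Nat.find (exists_lt_two_pow_two_pow n)

theorem lt_two_pow_magnitudeOf (n : ℕ) : n < 2 ^ 2 ^ magnitudeOf n :=
  Nat.find_spec (exists_lt_two_pow_two_pow n)

theorem magnitudeOf_le {n e : ℕ} (h : n < 2 ^ 2 ^ e) : magnitudeOf n ≤ e :=
  Nat.find_min' (exists_lt_two_pow_two_pow n) h

theorem not_lt_of_lt_magnitudeOf {n e : ℕ} (h : e < magnitudeOf n) : ¬ n < 2 ^ 2 ^ e :=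
  Nat.find_min (exists_lt_two_pow_two_pow n) h

/-- The answer is at most a sum of two numbers of `2 ^ e` bits, hence one extra bit. -/
theorem lcpAnswer_lt {T : List β} {k p l e : ℕ} (hk : phraseEnd T k < 2 ^ 2 ^ e)
    (hl : l < 2 ^ 2 ^ e) : lcpAnswer T k p l < 2 ^ (2 ^ e + 1) := by
  have h := (lcp_prefix_left (phrasePrefix T k ++ ((phrasePrefix T k).drop p).take l) T).length_le
  rw [List.length_append, length_phrasePrefix, List.length_take] at h
  rw [lcpAnswer, pow_succ]
  omega

/-- The last steps of the protocol, after the binary search. -/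
theorem finishes_magnitude (b : ℕ) (code : List β → ℕ) (f g : X → List β) (r : Coins) (x y : X)
    (k : ℕ) : ∃ o, (lcpProtocol b code f g).Finishes r x y (magnitude k 0)
      (magnitudeOf (phraseEnd (f x) k) + 3)
      (2 * magnitudeOf (phraseEnd (f x) k) + 6 * 2 ^ magnitudeOf (phraseEnd (f x) k) + 4) o ∧
      (¬ f x <+: g y → ¬ g y <+: f x → phrasePrefix (f x) k = phrasePrefix (g y) k →
        phrasePrefix (f x) (k + 1) ≠ phrasePrefix (g y) (k + 1) → o = (lcp (f x) (g y)).length) := by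
  set e := magnitudeOf (phraseEnd (f x) k) with he
  have hlt : phraseEnd (f x) k < 2 ^ 2 ^ e := lt_two_pow_magnitudeOf _
  -- A failed search may deliver any `k`. The protocol must still stop, so the decoded values are
  -- identified only when a next phrase exists.
  obtain ⟨p, l, hpl, hpl'⟩ : ∃ p l, (lcpProtocol b code f g).advance r x y (source k e) =
      answer k e p l ∧ (phraseEnd (f x) k < (f x).length →
        p = sourcePos (f x) k ∧ l = nextCopyLength (f x) k) := by
    by_cases h : phraseEnd (f x) k < (f x).length
    · obtain ⟨h1, h2, -⟩ := sourcePos_spec h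
      exact ⟨_, _, advance_source b code f g r x y (h1.trans_lt hlt) (h2.trans_lt hlt),
        fun _ => ⟨rfl, rfl⟩⟩
    · exact ⟨_, _, rfl, fun h' => absurd h' h⟩
  obtain ⟨o, ho, ho'⟩ : ∃ o, (lcpProtocol b code f g).advance r x y (answer k e p l) =
      done o ∧ (lcpAnswer (g y) k p l < 2 ^ (2 ^ e + 1) → o = lcpAnswer (g y) k p l) := by
    by_cases h : lcpAnswer (g y) k p l < 2 ^ (2 ^ e + 1)
    · exact ⟨_, advance_answer b code f g r x y h, fun _ => rfl⟩
    · exact ⟨_, rfl, fun h' => absurd h' h⟩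
  refine ⟨o, ?_, fun hS hT hk hk' => ?_⟩
  · have h0 : (lcpProtocol b code f g).Finishes r x y (done o) 0 0 o := .halt rfl
    have h3 : (lcpProtocol b code f g).advance r x y (magnitude k e) = source k e := by
      rw [advance_magnitude, if_pos hlt]
    have h4 := ((h0.of_advance (s := answer k e p l) rfl ho).of_advance
      (s := source k e) rfl hpl).of_advance (s := magnitude k e) rfl h3
    have h5 := BlockProtocol.Finishes.of_steps (M := lcpProtocol b code f g) (r := r) (x := x)
      (y := y) (fun i => magnitude k i) e 1 (fun _ _ => rfl)
      (fun i hi => by rw [advance_magnitude, if_neg (not_lt_of_lt_magnitudeOf (he ▸ hi))])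
      (fun _ _ => rfl) h4
    convert h5 using 1
    · ring
    · change _ = 0 + 2 * (2 ^ e + 1) + 2 * (2 ^ e + 2 ^ e) + 2 * 1 + e * (2 * 1)
      ring
  · have hkl := phraseEnd_lt_length hS hk
    obtain ⟨rfl, rfl⟩ := hpl' hkl
    obtain ⟨h1, h2, h3⟩ := sourcePos_spec hkl
    -- As the phrase prefixes agree, Bob's reconstruction from his own prefix is Alice's string cut
    -- after the copied part.
    rw [ho' (lcpAnswer_lt (by rwa [← phraseEnd_eq_of_phrasePrefix_eq hk]) (h2.trans_lt hlt)),
      lcp_eq_of_phrasePrefix_succ_ne hS hT hk hk', h3, lcpAnswer, hk]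

/-- The protocol expands the search range up to `2 ^ j`, searches for the index `k` and ends with
the last steps for `k`. -/
theorem finishes_of_expand {j k : ℕ}
    (hlt : ∀ i < j, hashTest b (phraseCode code (f x)) (phraseCode code (g y)) r i (2 ^ i) = true ∧
      phraseEnd (f x) (2 ^ i) ≠ (f x).length)
    (hj : ¬ (hashTest b (phraseCode code (f x)) (phraseCode code (g y)) r j (2 ^ j) = true ∧
      phraseEnd (f x) (2 ^ j) ≠ (f x).length))
    (hk : k = searchLo (searchRun
      (hashTest b (phraseCode code (f x)) (phraseCode code (g y)) r) (2 ^ j) (3 * j)))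
    {n c o : ℕ} (h : (lcpProtocol b code f g).Finishes r x y (magnitude k 0) n c o) :
    (lcpProtocol b code f g).Finishes r x y (expand 0) (n + (4 * j + 2))
      (c + ((j + 1) * (2 * (b + 1)) + (3 * j + 1) * (2 * (b + b + 1)))) o := by
  subst hk
  have h1 := BlockProtocol.Finishes.of_steps (M := lcpProtocol b code f g) (r := r) (x := x)
      (y := y) (fun i => search j i (searchRun
      (hashTest b (phraseCode code (f x)) (phraseCode code (g y)) r) (2 ^ j) i)) (3 * j)
      (b + b + 1) (fun _ _ => rfl) (fun i hi => advance_search b code f g r x y hi _)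
      (fun _ _ => rfl)
      (h.of_advance rfl (advance_search_last b code f g r x y j _))
  have h2 : (lcpProtocol b code f g).advance r x y (expand j) = search j 0 ([0], 2 ^ j) := by
    rw [advance_expand, if_neg hj]
  have h3 := BlockProtocol.Finishes.of_steps (M := lcpProtocol b code f g) (r := r) (x := x)
      (y := y) (fun i => expand i) j (b + 1) (fun _ _ => rfl)
      (fun i hi => by rw [advance_expand, if_pos (hlt i hi)]) (fun _ _ => rfl)
      (h1.of_advance rfl h2)
  convert h3 using 1
  · ring
  · change _ = c + 2 * (b + b + 1) + 3 * j * (2 * (b + b + 1)) + 2 * (b + 1) + j * (2 * (b + 1))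
    ring

theorem exists_finishes (b : ℕ) (code : List β → ℕ) (f g : X → List β) (r : Coins) (x y : X) :
    ∃ n c o, (lcpProtocol b code f g).Finishes r x y (expand 0) n c o := by
  classical
  have hex : ∃ j, ¬ (hashTest b (phraseCode code (f x)) (phraseCode code (g y)) r j (2 ^ j) = true ∧
      phraseEnd (f x) (2 ^ j) ≠ (f x).length) := by
    refine ⟨(f x).length, fun h => h.2 ?_⟩
    have h1 := min_le_phraseEnd (f x) (2 ^ (f x).length)
    have h2 := phraseEnd_le_length (f x) (2 ^ (f x).length)
    have h3 : (f x).length < 2 ^ (f x).length := Nat.lt_two_pow_self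
    omega
  obtain ⟨o, ho, -⟩ := finishes_magnitude b code f g r x y (searchLo (searchRun
      (hashTest b (phraseCode code (f x)) (phraseCode code (g y)) r) (2 ^ Nat.find hex)
      (3 * Nat.find hex)))
  exact ⟨_, _, o, finishes_of_expand (fun i hi => not_not.mp (Nat.find_min hex hi))
    (Nat.find_spec hex) rfl ho⟩

end LcpProtocol

/-! ### Error probability and cost -/

section Analysis

open MeasureTheory
open scoped ENNReal

variable {X β : Type*} {b : ℕ} {code : List β → ℕ} {f g : X → List β} {x y : X}

theorem phraseCode_eq_iff (hcode : Function.Injective code) {S T : List β} {k : ℕ} :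
    phraseCode code S k = phraseCode code T k ↔ phrasePrefix S k = phrasePrefix T k :=
  hcode.eq_iff

/-- With high probability, the protocol is correct, and its numbers of steps and bits are bounded
in terms of the least `j` such that the first `2 ^ j` phrases of the two strings differ. -/
theorem coinLaw_lcpProtocol_fails_le (hcode : Function.Injective code) (hfg : ¬ f x <+: g y)
    (hgf : ¬ g y <+: f x) {j : ℕ}
    (hj : phrasePrefix (f x) (2 ^ j) ≠ phrasePrefix (g y) (2 ^ j))
    (hlt : ∀ i < j, phrasePrefix (f x) (2 ^ i) = phrasePrefix (g y) (2 ^ i)) :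
    coinLaw {r | ¬ ∃ e ≤ j, (∀ i < e, 2 ^ 2 ^ i ≤ (lcp (f x) (g y)).length) ∧
      (lcpProtocol b code f g).Finishes r x y (.expand 0) (4 * j + e + 5)
        (2 * e + 6 * 2 ^ e + 4 + ((j + 1) * (2 * (b + 1)) + (3 * j + 1) * (2 * (b + b + 1))))
        (lcp (f x) (g y)).length} ≤ 7 * (1 / 2) ^ b := by
  set xs := phraseCode code (f x) with hxs
  set ys := phraseCode code (g y) with hys
  have hiff (k : ℕ) : xs k = ys k ↔ phrasePrefix (f x) k = phrasePrefix (g y) k :=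
    phraseCode_eq_iff hcode
  have hanti : Antitone fun k => xs k = ys k := fun i k hik h =>
    (hiff i).mpr (phrasePrefix_eq_of_le hik ((hiff k).mp h))
  have h0 : xs 0 = ys 0 := (hiff 0).mpr (by simp [phrasePrefix, phraseEnd])
  have hne : xs (2 ^ j) ≠ ys (2 ^ j) := fun h => hj ((hiff _).mp h)
  have hsub : {r | ¬ ∃ e ≤ j, (∀ i < e, 2 ^ 2 ^ i ≤ (lcp (f x) (g y)).length) ∧
      (lcpProtocol b code f g).Finishes r x y (.expand 0) (4 * j + e + 5)
        (2 * e + 6 * 2 ^ e + 4 + ((j + 1) * (2 * (b + 1)) + (3 * j + 1) * (2 * (b + b + 1))))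
        (lcp (f x) (g y)).length} ⊆
      -- Only two failures matter: a collision at `2 ^ j`, where the expansion should stop, and a
      -- failed search. The two stages share coin blocks, which a union bound permits.
      {r | hashAgree b r j (xs (2 ^ j)) (ys (2 ^ j)) = true} ∪
      {r | ¬ ∃ lo stk, searchRun (hashTest b xs ys r) (2 ^ j) (3 * j) = (lo :: stk, lo + 1) ∧
        xs lo = ys lo ∧ xs (lo + 1) ≠ ys (lo + 1) ∧ lo < 2 ^ j} := by
    intro r hr
    by_contra hcon
    rw [Set.mem_union, not_or] at hcon
    obtain ⟨hc1, hc2⟩ := hcon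
    obtain ⟨lo, stk, hrun, hlo, hlo', hloj⟩ := not_not.mp hc2
    have heq := (hiff lo).mp hlo
    obtain ⟨o, ho, ho'⟩ := finishes_magnitude b code f g r x y lo
    have hfin := finishes_of_expand (r := r) (k := lo) (j := j) (b := b) (code := code)
      (fun i hi => ⟨by rw [hashTest, ← hxs, ← hys, (hiff _).mpr (hlt i hi), hashAgree_self],
        (phraseEnd_lt_length hfg (hlt i hi)).ne⟩)
      (fun h => hc1 h.1) (by rw [hrun]; rfl) ho
    rw [ho' hfg hgf heq fun h => hlo' ((hiff _).mpr h)] at hfin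
    refine hr ⟨magnitudeOf (phraseEnd (f x) lo), ?_, fun i hi => ?_, ?_⟩
    -- The common phrases end before `2 ^ lo < 2 ^ 2 ^ j`, so `e ≤ j` and the magnitude stage stays
    -- within the round budget.
    · exact magnitudeOf_le ((phraseEnd_lt_two_pow _ _).trans (Nat.pow_lt_pow_right (by norm_num) hloj))
    · exact (not_lt.mp (not_lt_of_lt_magnitudeOf hi)).trans (phraseEnd_le_length_lcp heq)
    · convert hfin using 1
      ring
  calc _ ≤ _ := measure_mono hsub
    _ ≤ (1 / 2) ^ b + 6 * (1 / 2) ^ b := (measure_union_le _ _).trans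
        (add_le_add (coinLaw_hashAgree b j hne).le
          (coinLaw_search_fails_le b xs ys hanti h0 hne))
    _ = 7 * (1 / 2) ^ b := by ring

/-- The last failed test gives `2 ^ (e - 1) ≤ lg n`; squaring the bound at each attempt overshoots
the bit length by a factor of at most two. -/
theorem two_pow_le_two_mul_logb {e : ℕ} {n : ℕ} (h : ∀ i < e, 2 ^ 2 ^ i ≤ n) :
    (2 : ℝ) ^ e ≤ 2 * Real.logb 2 (n + 2) := by
  have h2 : (1 : ℝ) ≤ Real.logb 2 (n + 2) := by
    rw [Real.le_logb_iff_rpow_le (by norm_num) (by positivity)]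
    simp
  cases e with
  | zero => simp; linarith
  | succ e =>
    have h3 : ((2 : ℝ) ^ e) ≤ Real.logb 2 (n + 2) := by
      rw [Real.le_logb_iff_rpow_le (by norm_num) (by positivity)]
      have h4 : ((2 ^ 2 ^ e : ℕ) : ℝ) ≤ n := by exact_mod_cast h e (by omega)
      rw [show ((2 : ℝ) ^ e) = ((2 ^ e : ℕ) : ℝ) by push_cast; rfl, Real.rpow_natCast]
      push_cast at h4
      linarith
    rw [pow_succ]
    linarith

theorem le_logb_add_one {j z : ℕ} (h : ∀ i < j, 2 ^ i ≤ z) :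
    (j : ℝ) ≤ Real.logb 2 (z + 2) + 1 := by
  have h2 : (1 : ℝ) ≤ Real.logb 2 (z + 2) := by
    rw [Real.le_logb_iff_rpow_le (by norm_num) (by positivity)]
    simp
  cases j with
  | zero => simp; linarith
  | succ j =>
    have h3 : (j : ℝ) ≤ Real.logb 2 (z + 2) := by
      rw [Real.le_logb_iff_rpow_le (by norm_num) (by positivity), Real.rpow_natCast]
      have h4 : ((2 ^ j : ℕ) : ℝ) ≤ z := by exact_mod_cast h j (by omega)
      push_cast at h4
      linarith
    push_cast
    linarith

/-- A string with an end marker. -/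
def markEnd {α : Type*} (v : Bool) (A : List α) : List (α ⊕ Bool) := A.map Sum.inl ++ [Sum.inr v]

theorem lcp_markEnd {α : Type*} {v w : Bool} (hvw : v ≠ w) (A B : List α) :
    lcp (markEnd v A) (markEnd w B) = (lcp A B).map Sum.inl :=
  lcp_map_append_singleton Sum.inl_injective (by simp) (by simp) (by simpa using hvw) A B

theorem not_markEnd_prefix {α : Type*} {v w : Bool} (hvw : v ≠ w) (A B : List α) :
    ¬ markEnd v A <+: markEnd w B := by
  intro h
  have h1 := prefix_lcp List.prefix_rfl h
  rw [lcp_markEnd hvw] at h1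
  have h2 : (Sum.inr v : α ⊕ Bool) ∈ (lcp A B).map Sum.inl := h1.subset (by simp [markEnd])
  simp at h2

end Analysis

theorem theorem1 (ε : ℝ) (hε : 0 < ε) (hε' : ε < 1 / 2) :
    ∃ C : ℝ, ∀ (α : Type*) [Countable α],
      ∃ P : PublicCoinProtocol (List α) (List α) ℕ, ∀ A B : List α,
        (∀ r, ∃ t o, (P.det r).HaltsWith A B t o) ∧
        ENNReal.ofReal (1 - ε) ≤ coinLaw {r | ∃ t : Transcript,
          (P.det r).HaltsWith A B t (lcp A B).length ∧
          (t.rounds : ℝ) ≤ C * Real.logb 2 ((lz77 (lcp A B)).length + 2) ∧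
          (t.bits : ℝ) ≤ C * Real.logb 2 ((lcp A B).length + 2)} := by
  classical
  obtain ⟨b, hb⟩ : ∃ b : ℕ, (1 / 2 : ℝ) ^ b < ε / 7 :=
    exists_pow_lt_of_lt_one (by positivity) (by norm_num)
  -- With `j ≤ lg (ℓ + 2) + 1`, `e ≤ j` and `2 ^ e ≤ 2 * lg (ℓ + 2)`, the bit count is at most `(34
  -- * b + 40) * lg (ℓ + 2)`; the rounds need only `30 * lg (z + 2)`.
  refine ⟨34 * b + 46, fun α _ => ?_⟩
  obtain ⟨code, hcode⟩ := exists_injective_nat (List (α ⊕ Bool))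
  refine ⟨(lcpProtocol b code (markEnd true) (markEnd false)).toPublicCoin, fun A B => ⟨?_, ?_⟩⟩
  · intro r
    obtain ⟨n, c, o, h⟩ := exists_finishes b code (markEnd true) (markEnd false) r A B
    obtain ⟨t, ht, -⟩ := h.exists_transcript
    exact ⟨t, o, ht⟩
  set S := markEnd true A with hS
  set T := markEnd false B with hT
  set z := (lz77 (lcp A B)).length with hz
  set ℓ := (lcp A B).length with hℓ
  have hlcp : lcp S T = (lcp A B).map Sum.inl := lcp_markEnd (by simp) A B
  have hlen : (lcp S T).length = ℓ := by rw [hlcp, List.length_map]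
  have hST : ¬ S <+: T := not_markEnd_prefix (by simp) A B
  have hTS : ¬ T <+: S := not_markEnd_prefix (by simp) B A
  have hzne : phrasePrefix S (z + 1) ≠ phrasePrefix T (z + 1) := by
    refine phrasePrefix_succ_ne hST ?_
    rw [hlcp, phraseEnd_map Sum.inl_injective, List.length_map, phraseEnd_length_lz77]
  have hex : ∃ j, phrasePrefix S (2 ^ j) ≠ phrasePrefix T (2 ^ j) :=
    ⟨z + 1, fun h => hzne (phrasePrefix_eq_of_le Nat.lt_two_pow_self.le h)⟩
  set j := Nat.find hex with hj
  have hjlt (i : ℕ) (hi : i < j) : phrasePrefix S (2 ^ i) = phrasePrefix T (2 ^ i) :=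
    not_not.mp (Nat.find_min hex hi)
  have hjz (i : ℕ) (hi : i < j) : 2 ^ i ≤ z := by
    by_contra hgt
    exact hzne (phrasePrefix_eq_of_le (by omega) (hjlt i hi))
  have hzℓ : z ≤ ℓ := length_lz77_le _
  have hbad := coinLaw_lcpProtocol_fails_le (b := b) (f := markEnd true) (g := markEnd false)
    (x := A) (y := B) hcode hST hTS (Nat.find_spec hex) hjlt
  have hbad' : (7 : ENNReal) * (1 / 2) ^ b ≤ ENNReal.ofReal ε := by
    have h1 : (7 : ENNReal) * (1 / 2) ^ b = ENNReal.ofReal (7 * (1 / 2) ^ b) := by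
      rw [ENNReal.ofReal_mul (by norm_num), ENNReal.ofReal_pow (by norm_num),
        ENNReal.ofReal_div_of_pos (by norm_num)]
      simp
    rw [h1]
    exact ENNReal.ofReal_le_ofReal (by linarith)
  set G : Set Coins := {r | ∃ t : Transcript,
    ((lcpProtocol b code (markEnd true) (markEnd false)).toPublicCoin.det r).HaltsWith A B t ℓ ∧
      (t.rounds : ℝ) ≤ (34 * b + 46) * Real.logb 2 (z + 2) ∧
      (t.bits : ℝ) ≤ (34 * b + 46) * Real.logb 2 (ℓ + 2)} with hG
  have hcompl : Gᶜ ⊆ {r | ¬ ∃ e ≤ j, (∀ i < e, 2 ^ 2 ^ i ≤ (lcp S T).length) ∧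
      (lcpProtocol b code (markEnd true) (markEnd false)).Finishes r A B (.expand 0) (4 * j + e + 5)
        (2 * e + 6 * 2 ^ e + 4 + ((j + 1) * (2 * (b + 1)) + (3 * j + 1) * (2 * (b + b + 1))))
        (lcp S T).length} := by
    rintro r hr ⟨e, hej, he, hfin⟩
    apply hr
    rw [hlen] at hfin he
    obtain ⟨t, ht, hrounds, hbits⟩ := hfin.exists_transcript
    refine ⟨t, ht, ?_, ?_⟩
    · have h1 := le_logb_add_one hjz
      have h2 : (1 : ℝ) ≤ Real.logb 2 (z + 2) := by
        rw [Real.le_logb_iff_rpow_le (by norm_num) (by positivity)]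
        simp
      have h3 : (t.rounds : ℝ) ≤ 2 * (4 * j + e + 5) := by exact_mod_cast hrounds
      have h4 : (e : ℝ) ≤ j := by exact_mod_cast hej
      have h5 : 0 ≤ (b : ℝ) * Real.logb 2 (z + 2) := by positivity
      linarith
    · have h1 := le_logb_add_one fun i hi => (hjz i hi).trans hzℓ
      have h2 : (1 : ℝ) ≤ Real.logb 2 (ℓ + 2) := by
        rw [Real.le_logb_iff_rpow_le (by norm_num) (by positivity)]
        simp
      have h3 := two_pow_le_two_mul_logb he
      have h4 : (e : ℝ) ≤ j := by exact_mod_cast hej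
      rw [hbits]
      push_cast
      have h5 : (j : ℝ) * b ≤ (Real.logb 2 (ℓ + 2) + 1) * b := by gcongr
      have h6 : (b : ℝ) ≤ b * Real.logb 2 (ℓ + 2) := le_mul_of_one_le_right (by positivity) h2
      linarith
  have hGc : coinLaw Gᶜ ≤ ENNReal.ofReal ε := (MeasureTheory.measure_mono hcompl).trans (hbad.trans hbad')
  -- Subadditivity suffices here, so `G` need not be shown measurable.
  have huniv : (1 : ENNReal) ≤ coinLaw G + coinLaw Gᶜ := by
    rw [← MeasureTheory.measure_univ (μ := coinLaw), ← Set.union_compl_self G]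
    exact MeasureTheory.measure_union_le _ _
  rw [ENNReal.ofReal_sub _ hε.le, ENNReal.ofReal_one]
  exact tsub_le_iff_right.mpr (huniv.trans (by gcongr))
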